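/- Let $n\ge 0$. An $n$-punctured ball tangle diagram $T$ is a (planar, regular) diagram, in a closed disc $D_0$ with the interiors of $n$ disjoint numbered closed discs $D_1,\dots,D_n\subset \operatorname{Int} D_0$ (the holes) removed, of a compact 1-manifold whose boundary consists of four points on each circle $\partial D_k$, $0\le k\le n$; these four points are called NW, SW, SE, NE, in this counterclockwise order in the plane. There are finitely many crossings, and closed components are allowed. The Kauffman bracket of a nonempty link diagram $L$ at $A=e^{i\pi/4}$ is $$\langle L\rangle=\sum_{\sigma}A^{\alpha(\sigma)}(A^{-1})^{\beta(\sigma)}(-A^2-A^{-2})^{d(\sigma)-1},$$ where $\sigma$ runs over all choices of an $A$-type or a $B$-type splitting at each crossing (with $0^0=1$), $\alpha(\sigma)$ and $\beta(\sigma)$ are the numbers of $A$-type and $B$-type splittings in $\sigma$, and $d(\sigma)$ is the number of circles of the resolved diagram. (The $A$-type splitting joins the two regions swept out when the overcrossing strand is turned counterclockwise; the $B$-type splitting joins the other two.) The fundamental tangle $1$ consists of two arcs joining NW to SW and NE to SE, the fundamental tangle $2$ of two arcs joining NW to NE and SW to SE. For $\alpha\in\{1,2\}^n$ let $T_{1\alpha}$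 (respectively $T_{2\alpha}$) be the link diagram obtained from $T$ by filling the $k$-th hole with the fundamental tangle $\alpha_k$ for $k=1,\dots,n$, and taking the numerator closure, which joins NW to NE and SW to SE outside $D_0$ (respectively the denominator closure, which joins NW to SW and NE to SE). Let $\alpha^n_1<\dots<\alpha^n_{2^n}$ be the elements of $\{1,2\}^n$ in lexicographic order, and define $t_1,\dots,t_{2^n}$ by the list $(0)$ for $n=0$ and, for $n\geq1$, by the list for $n-1$ followed by the same list with $1$ added to every entry. The invariant of $T$ is the set of integer matrices $$F^n(T)=\left\{\begin{pmatrix}(-i)^{t_1}z\langle T_{1\alpha^n_1}\rangle&\cdots&(-i)^{t_{2^n}}z\langle T_{1\alpha^n_{2^n}}\rangle\\(-i)^{t_1}iz\langle T_{2\alpha^n_1}\rangle&\cdots&(-i)^{t_{2^n}}iz\langle T_{2\alpha^n_{2^n}}\rangle\end{pmatrix}\ \middle|\ z\in\mathbb C,\ z^8=1\right\}\cap M_{2\times2^n}(\mathbb Z).$$ For an integer matrix $M$ write $[M]=\{M,-M\}$. Let $T^{(1)}$ and $T^{(2)}$ be $k_1$- and $k_2$-punctured ball tangle diagrams, $k_1,k_2\ge0$.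 The horizontal connect sum $T^{(1)}+_hT^{(2)}$ is the $(k_1+k_2)$-punctured ball tangle diagram obtained by placing $T^{(1)}$ to the left of $T^{(2)}$ and joining the outer points NE and SE of $T^{(1)}$ to the outer points NW and SW of $T^{(2)}$, respectively. The vertical connect sum $T^{(1)}+_vT^{(2)}$ is obtained by placing $T^{(1)}$ above $T^{(2)}$ and joining the outer points SW and SE of $T^{(1)}$ to the outer points NW and NE of $T^{(2)}$, respectively. In both cases the four remaining outer points, in their positions, are the outer points of the sum, and the holes of $T^{(1)}$ are numbered before those of $T^{(2)}$. **Theorem.** Let $a=(a_{ri})$ and $b=(b_{rj})$ be integer matrices of sizes $2\times2^{k_1}$ and $2\times2^{k_2}$ such that $F^{k_1}(T^{(1)})=[a]$ and $F^{k_2}(T^{(2)})=[b]$. Then (1) $F^{k_1+k_2}(T^{(1)}+_hT^{(2)})=[M_h]$, where $M_h$ is the $2\times2^{k_1+k_2}$ matrix with columns $\begin{pmatrix}a_{1i}b_{2j}+a_{2i}b_{1j}\\a_{2i}b_{2j}\end{pmatrix}$; (2) $F^{k_1+k_2}(T^{(1)}+_vT^{(2)})=[M_v]$, where $M_v$ is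 the $2\times2^{k_1+k_2}$ matrix with columns $\begin{pmatrix}a_{1i}b_{1j}\\a_{2i}b_{1j}+a_{1i}b_{2j}\end{pmatrix}$; in both cases the columns are indexed by the pairs $(i,j)$ with $1\le i\le2^{k_1}$, $1\le j\le2^{k_2}$, in lexicographic order. -/

import Mathlib

/-!
Combinatorial diagrams of links and of punctured ball tangles on the projection plane, the
Kauffman bracket, and the punctured ball tangle invariant.

A diagram is recorded by its crossings and by the way in which arcs join them. The boundary of each
of the balls `H_0, …, H_n` projects to a circle that carries four endpoints; they are numbered
counterclockwise in the plane, `0 = NW`, `1 = SW`, `2 = SE`, `3 = NE`.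
-/

namespace PBT

/-- The ends of the arcs of a diagram with crossings `C`, bivalent points `P` and boundary
circles `B`. The four ends at a crossing are numbered counterclockwise; the ends `0` and `2` lie on
the strand that passes over, `1` and `3` on the one that passes under. A bivalent point is an
ordinary point of the diagram chosen to subdivide it. A boundary circle carries four endpoints. -/
inductive HalfEdge (C P B : Type) : Type
  | crossing (c : C) (i : Fin 4)
  | point (p : P) (i : Fin 2)
  | boundary (b : B) (i : Fin 4)

/-- A diagram with boundary circles `B`: finitely many crossings, finitely many bivalent points,
and arcs, given by the fixed point free involution that sends an end of an arc to its other end.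
(A closed curve without crossings is a bivalent point whose two ends are joined by an arc.) -/
structure Diagram (B : Type) where
  Crossing : Type
  Point : Type
  [fintypeCrossing : Fintype Crossing]
  [decidableEqCrossing : DecidableEq Crossing]
  [finitePoint : Finite Point]
  arc : HalfEdge Crossing Point B → HalfEdge Crossing Point B
  arc_arc : ∀ e, arc (arc e) = e
  arc_ne : ∀ e, arc e ≠ e

attribute [instance] Diagram.fintypeCrossing Diagram.decidableEqCrossing Diagram.finitePoint

/-- The half-edges of a diagram. -/
abbrev Diagram.Ends {B : Type} (D : Diagram B) : Type := HalfEdge D.Crossing D.Point B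

/-- Transport the arcs of a system of ends along a bijection. -/
def conjArc {α β : Type} (φ : α ≃ β) (f : β → β) (x : α) : α := φ.symm (f (φ x))

theorem conjArc_conjArc {α β : Type} (φ : α ≃ β) (f : β → β) (hf : ∀ y, f (f y) = y) (x : α) :
    conjArc φ f (conjArc φ f x) = x := by
  simp [conjArc, hf]

theorem conjArc_ne {α β : Type} (φ : α ≃ β) (f : β → β) (hf : ∀ y, f y ≠ y) (x : α) :
    conjArc φ f x ≠ x := by
  intro h
  exact hf (φ x) ((Equiv.symm_apply_eq φ).1 h)

/-! ### Link diagrams and the Kauffman bracket -/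

/-- Link diagrams: no boundary circles. -/
abbrev LinkDiagram : Type 1 := Diagram Empty

/-- Splitting a crossing: how the four ends are reconnected. The `A`-type splitting (`true`) opens
a channel between the two regions swept out when the overcrossing strand turns counterclockwise,
that is, between the region at the ends `0, 1` and the region at the ends `2, 3`;
the `B`-type splitting (`false`) joins the other two regions. -/
def split : Bool → Fin 4 → Fin 4
  | true => ![3, 2, 1, 0]
  | false => ![1, 0, 3, 2]

/-- A state chooses the `A`-type (`true`) or the `B`-type (`false`) splitting at each crossing. -/
abbrev LinkDiagram.State (L : LinkDiagram) : Type := L.Crossing → Bool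

/-- In the resolution `L_σ`, an end of an arc at a crossing or at a bivalent point continues in
another end there. -/
def LinkDiagram.join (L : LinkDiagram) (σ : L.State) : L.Ends → L.Ends
  | .crossing c i => .crossing c (split (σ c) i)
  | .point p i => .point p i.rev

/-- `d(σ)`: the number of circles (connected components) of the resolution `L_σ`. -/
noncomputable def LinkDiagram.circles (L : LinkDiagram) (σ : L.State) : ℕ :=
  Nat.card (Quot fun x y : L.Ends => y = L.arc x ∨ y = L.join σ x)

/-- The Kauffman bracket `⟨L⟩_A` of a (nonempty) link diagram. -/
noncomputable def LinkDiagram.bracket (A : ℂ) (L : LinkDiagram) : ℂ :=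
  ∑ σ : L.State,
    A ^ (Finset.univ.filter fun c => σ c = true).card *
      A⁻¹ ^ (Finset.univ.filter fun c => σ c = false).card *
      (-A ^ 2 - A⁻¹ ^ 2) ^ (L.circles σ - 1)

/-- The Kauffman bracket at `A = e^{iπ/4}`. -/
noncomputable def LinkDiagram.kauffman (L : LinkDiagram) : ℂ :=
  L.bracket (Complex.exp (Complex.I * Real.pi / 4))

/-! ### Punctured ball tangle diagrams -/

/-- Diagrams with `n + 1` boundary circles: `none` is the outer circle `∂H_0`, and `some k` is the
circle of the hole number `k`. Those which lie in the plane are singled out below. -/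
abbrev TangleDiagram (n : ℕ) : Type 1 := Diagram (Option (Fin n))

/-- Shrink every boundary circle to a vertex on the sphere. This sends an end at a vertex to the
next end at that vertex in counterclockwise order. Around the outer circle, seen from the point at
infinity, the order is reversed. -/
def TangleDiagram.next {n : ℕ} (T : TangleDiagram n) : T.Ends → T.Ends
  | .crossing c i => .crossing c (i + 1)
  | .point p i => .point p (i + 1)
  | .boundary (some k) i => .boundary (some k) (i + 1)
  | .boundary none i => .boundary none (i - 1)

/-- The diagram can be drawn in the plane, in the outer disc minus the holes: every connected
component of the cellular surface determined by the cyclic orders is a sphere, i.e.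
`#vertices - #edges + #faces = 2 #components`. -/
def TangleDiagram.IsPlanar {n : ℕ} (T : TangleDiagram n) : Prop :=
  Nat.card (Quot fun x y : T.Ends => y = T.next x) +
      Nat.card (Quot fun x y : T.Ends => y = T.next (T.arc x)) =
    Nat.card (Quot fun x y : T.Ends => y = T.arc x) +
      2 * Nat.card (Quot fun x y : T.Ends => y = T.arc x ∨ y = T.next x)

/-- The two ways of joining four points on a circle by two disjoint arcs: `0` joins
`{NW, SW}` and `{SE, NE}`, and `1` joins `{NW, NE}` and `{SW, SE}`. The pair `(s, e)` is sent to the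
end number `e` of the arc number `s`. -/
def matching : Fin 2 → (Fin 2 × Fin 2 ≃ Fin 4)
  | 0 => ⟨fun x => ![![0, 1], ![2, 3]] x.1 x.2, ![(0, 0), (0, 1), (1, 0), (1, 1)],
      by decide, by decide⟩
  | 1 => ⟨fun x => ![![0, 3], ![1, 2]] x.1 x.2, ![(0, 0), (1, 0), (1, 1), (0, 1)],
      by decide, by decide⟩

/-- After a boundary circle `b` is closed up by the two arcs of `matching (κ b)`, each of these arcs
has a bivalent point `(b, s)` on it, and its two ends are the former endpoints on the circle. -/
def closeEnds {B : Type} (C P : Type) (κ : B → Fin 2) :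
    HalfEdge C (P ⊕ B × Fin 2) Empty ≃ HalfEdge C P B where
  toFun
    | .crossing c i => .crossing c i
    | .point (.inl p) i => .point p i
    | .point (.inr (b, s)) i => .boundary b (matching (κ b) (s, i))
  invFun
    | .crossing c i => .crossing c i
    | .point p i => .point (.inl p) i
    | .boundary b i =>
        .point (.inr (b, ((matching (κ b)).symm i).1)) ((matching (κ b)).symm i).2
  left_inv := by
    rintro (⟨c, i⟩ | ⟨p | ⟨b, s⟩, i⟩ | ⟨b, i⟩) <;> first | rfl | exact b.elim | simp
  right_inv := by
    rintro (⟨c, i⟩ | ⟨p, i⟩ | ⟨b, i⟩) <;> simp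

/-- The link diagram obtained by closing up every boundary circle `b` by two disjoint arcs,
according to `κ b`. -/
def Diagram.close {B : Type} [Finite B] (D : Diagram B) (κ : B → Fin 2) : LinkDiagram where
  Crossing := D.Crossing
  Point := D.Point ⊕ B × Fin 2
  arc := conjArc (closeEnds D.Crossing D.Point κ) D.arc
  arc_arc := conjArc_conjArc _ _ D.arc_arc
  arc_ne := conjArc_ne _ _ D.arc_ne

/-- The link diagram `T_{iα}`, with `0, 1 : Fin 2` standing for the subscripts `1, 2`:
the numerator closure (`i = 0`, joining NW to NE and SW to SE) or the denominator closure (`i = 1`,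
joining NW to SW and NE to SE) of `T` with its hole number `k` filled by the fundamental
tangle `α k` (`0`: two vertical arcs, NW to SW and NE to SE; `1`: two horizontal arcs). -/
def TangleDiagram.closure {n : ℕ} (T : TangleDiagram n) (i : Fin 2) (α : Fin n → Fin 2) :
    LinkDiagram :=
  T.close fun b => b.elim i.rev α

/-! ### The invariant -/

/-- The `k`-th element, in dictionary order, of the set of `n`-tuples with two possible entries:
the binary digits of `k`, the most significant one first. -/
def dictIndex (n : ℕ) (k : Fin (2 ^ n)) : Fin n → Fin 2 :=
  fun j => ⟨(k : ℕ) / 2 ^ (n - 1 - (j : ℕ)) % 2, Nat.mod_lt _ two_pos⟩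

/-- The exponents `t_1, …, t_{2^n}` (numbered from `0` here): the list for `0` is `(0)`, and the
list for `n + 1` is the list for `n` followed by the same list with `1` added to every entry. -/
def expo : ℕ → ℕ → ℕ
  | 0, _ => 0
  | n + 1, k => if k < 2 ^ n then expo n k else expo n (k - 2 ^ n) + 1

/-- The complex matrix of brackets with entries `(-i)^{t_k} ⟨T_{1 α_k}⟩` and
`(-i)^{t_k} i ⟨T_{2 α_k}⟩`. -/
noncomputable def TangleDiagram.bracketMatrix {n : ℕ} (T : TangleDiagram n) :
    Matrix (Fin 2) (Fin (2 ^ n)) ℂ :=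
  Matrix.of fun i k =>
    (-Complex.I) ^ expo n k * Complex.I ^ (i : ℕ) * (T.closure i (dictIndex n k)).kauffman

/-- The invariant `F^n(T)`: the set of the integer matrices among the multiples of the bracket
matrix by eighth roots of unity. -/
noncomputable def TangleDiagram.invariant {n : ℕ} (T : TangleDiagram n) :
    Set (Matrix (Fin 2) (Fin (2 ^ n)) ℤ) :=
  {M | ∃ z : ℂ, z ^ 8 = 1 ∧ M.map (Int.cast : ℤ → ℂ) = z • T.bracketMatrix}

/-- The element `[M]` of `PM(ℤ)`: the class of the integer matrix `M` modulo multiplication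
by `±1`. -/
def projClass {ι κ : Type} (M : Matrix ι κ ℤ) : Set (Matrix ι κ ℤ) := {M, -M}

/-! ### Connect sums -/

/-- The ends on the outer circle of a connect sum and at the two points where the tangles are
glued, as ends on the outer circles of the two summands, for the horizontal connect sum: the first
tangle stands to the left of the second, `NE` of the first is glued to `NW` of the second (point
`0`) and `SE` of the first is glued to `SW` of the second (point `1`). -/
def hGlue : Fin 4 ⊕ Fin 2 × Fin 2 ≃ Fin 4 ⊕ Fin 4 where
  toFun := Sum.elim ![.inl 0, .inl 1, .inr 2, .inr 3]
    fun x => ![![.inl 3, .inr 0], ![.inl 2, .inr 1]] x.1 x.2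
  invFun := Sum.elim ![.inl 0, .inl 1, .inr (1, 0), .inr (0, 0)]
    ![.inr (0, 1), .inr (1, 1), .inl 2, .inl 3]
  left_inv := by decide
  right_inv := by decide

/-- The same for the vertical connect sum: the first tangle stands above the second, `SW` of the
first is glued to `NW` of the second (point `0`) and `SE` of the first is glued to `NE` of the
second (point `1`). -/
def vGlue : Fin 4 ⊕ Fin 2 × Fin 2 ≃ Fin 4 ⊕ Fin 4 where
  toFun := Sum.elim ![.inl 0, .inr 1, .inr 2, .inl 3]
    fun x => ![![.inl 1, .inr 0], ![.inl 2, .inr 3]] x.1 x.2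
  invFun := Sum.elim ![.inl 0, .inr (0, 0), .inr (1, 0), .inl 3]
    ![.inr (0, 1), .inl 1, .inl 2, .inr (1, 1)]
  left_inv := by decide
  right_inv := by decide

/-- The ends of a connect sum are the ends of the two summands. The holes of the first summand come
first. -/
def sumEnds (g : Fin 4 ⊕ Fin 2 × Fin 2 ≃ Fin 4 ⊕ Fin 4) (C₁ P₁ C₂ P₂ : Type) (k₁ k₂ : ℕ) :
    HalfEdge (C₁ ⊕ C₂) ((P₁ ⊕ P₂) ⊕ Fin 2) (Option (Fin (k₁ + k₂))) ≃
      HalfEdge C₁ P₁ (Option (Fin k₁)) ⊕ HalfEdge C₂ P₂ (Option (Fin k₂)) where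
  toFun
    | .crossing (.inl c) i => .inl (.crossing c i)
    | .crossing (.inr c) i => .inr (.crossing c i)
    | .point (.inl (.inl p)) i => .inl (.point p i)
    | .point (.inl (.inr p)) i => .inr (.point p i)
    | .point (.inr s) i => (g (.inr (s, i))).map (.boundary none) (.boundary none)
    | .boundary none i => (g (.inl i)).map (.boundary none) (.boundary none)
    | .boundary (some k) i =>
        (finSumFinEquiv.symm k).map (fun l => .boundary (some l) i) (fun l => .boundary (some l) i)
  invFun :=
    let outer : Fin 4 ⊕ Fin 2 × Fin 2 →
        HalfEdge (C₁ ⊕ C₂) ((P₁ ⊕ P₂) ⊕ Fin 2) (Option (Fin (k₁ + k₂))) :=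
      Sum.elim (fun i => .boundary none i) (fun x => .point (.inr x.1) x.2)
    Sum.elim
      (fun
        | .crossing c i => .crossing (.inl c) i
        | .point p i => .point (.inl (.inl p)) i
        | .boundary none i => outer (g.symm (.inl i))
        | .boundary (some l) i => .boundary (some (finSumFinEquiv (.inl l))) i)
      (fun
        | .crossing c i => .crossing (.inr c) i
        | .point p i => .point (.inl (.inr p)) i
        | .boundary none i => outer (g.symm (.inr i))
        | .boundary (some l) i => .boundary (some (finSumFinEquiv (.inr l))) i)
  left_inv := by
    rintro (⟨c | c, i⟩ | ⟨(p | p) | s, i⟩ | ⟨_ | k, i⟩)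
    · rfl
    · rfl
    · rfl
    · rfl
    · rcases h : g (.inr (s, i)) with j | j <;>
        simp [h, g.symm_apply_eq.2 h.symm]
    · rcases h : g (.inl i) with j | j <;>
        simp [h, g.symm_apply_eq.2 h.symm]
    · obtain ⟨l, rfl⟩ := finSumFinEquiv.surjective k
      rcases l with l | l <;> simp
  right_inv := by
    rintro ((⟨c, i⟩ | ⟨p, i⟩ | ⟨_ | k, i⟩) | (⟨c, i⟩ | ⟨p, i⟩ | ⟨_ | k, i⟩))
    · rfl
    · rfl
    · rcases h : g.symm (.inl i) with j | j <;>
        simp [h, ← g.symm_apply_eq.1 h]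
    · simp
    · rfl
    · rfl
    · rcases h : g.symm (.inr i) with j | j <;>
        simp [h, ← g.symm_apply_eq.1 h]
    · simp

/-- Two tangle diagrams glued along their outer circles as prescribed by `g`; the arcs of the
result are the arcs of the two diagrams. -/
def TangleDiagram.glue (g : Fin 4 ⊕ Fin 2 × Fin 2 ≃ Fin 4 ⊕ Fin 4) {k₁ k₂ : ℕ}
    (T₁ : TangleDiagram k₁) (T₂ : TangleDiagram k₂) : TangleDiagram (k₁ + k₂) where
  Crossing := T₁.Crossing ⊕ T₂.Crossing
  Point := (T₁.Point ⊕ T₂.Point) ⊕ Fin 2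
  arc := conjArc (sumEnds g T₁.Crossing T₁.Point T₂.Crossing T₂.Point k₁ k₂)
    (Sum.map T₁.arc T₂.arc)
  arc_arc := conjArc_conjArc _ _ (by rintro (y | y) <;> simp [T₁.arc_arc, T₂.arc_arc])
  arc_ne := conjArc_ne _ _ (by rintro (y | y) <;> simp [T₁.arc_ne, T₂.arc_ne])

/-- The horizontal connect sum `T₁ +_h T₂`. -/
def TangleDiagram.hsum {k₁ k₂ : ℕ} (T₁ : TangleDiagram k₁) (T₂ : TangleDiagram k₂) :
    TangleDiagram (k₁ + k₂) := TangleDiagram.glue hGlue T₁ T₂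

/-- The vertical connect sum `T₁ +_v T₂`. -/
def TangleDiagram.vsum {k₁ k₂ : ℕ} (T₁ : TangleDiagram k₁) (T₂ : TangleDiagram k₂) :
    TangleDiagram (k₁ + k₂) := TangleDiagram.glue vGlue T₁ T₂

/-- The lexicographic enumeration of the pairs of column numbers: with numbering from `0`, the pair
`(i, j)` has number `2 ^ k₂ * i + j`. -/
def pairIndex (k₁ k₂ : ℕ) : Fin (2 ^ k₁) × Fin (2 ^ k₂) ≃ Fin (2 ^ (k₁ + k₂)) :=
  finProdFinEquiv.trans (finCongr (pow_add 2 k₁ k₂).symm)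

/-- The matrix whose column with number `(i, j)` is `(a_{1i} b_{2j} + a_{2i} b_{1j}, a_{2i} b_{2j})`. -/
def hMatrix {k₁ k₂ : ℕ} (a : Matrix (Fin 2) (Fin (2 ^ k₁)) ℤ)
    (b : Matrix (Fin 2) (Fin (2 ^ k₂)) ℤ) : Matrix (Fin 2) (Fin (2 ^ (k₁ + k₂))) ℤ :=
  Matrix.of fun r c =>
    let i := ((pairIndex k₁ k₂).symm c).1
    let j := ((pairIndex k₁ k₂).symm c).2
    ![a 0 i * b 1 j + a 1 i * b 0 j, a 1 i * b 1 j] r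

/-- The matrix whose column with number `(i, j)` is `(a_{1i} b_{1j}, a_{2i} b_{1j} + a_{1i} b_{2j})`. -/
def vMatrix {k₁ k₂ : ℕ} (a : Matrix (Fin 2) (Fin (2 ^ k₁)) ℤ)
    (b : Matrix (Fin 2) (Fin (2 ^ k₂)) ℤ) : Matrix (Fin 2) (Fin (2 ^ (k₁ + k₂))) ℤ :=
  Matrix.of fun r c =>
    let i := ((pairIndex k₁ k₂).symm c).1
    let j := ((pairIndex k₁ k₂).symm c).2
    ![a 0 i * b 0 j, a 1 i * b 0 j + a 0 i * b 1 j] r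

end PBT

/-! At `A = e^{iπ/4}` one has `A² = i`, so a loop has the value `-A² - A⁻² = 0` and the bracket is a
weighted count of the states whose resolution is a single circle. Fix a state of a planar tangle
diagram and a filling of its holes. What remains is some closed components and two disjoint arcs
joining neighbouring outer points, that is, one of the two fundamental patterns `m`. The closure `i`
of it is a single circle exactly when there is no closed component and `m = i`. A closure of a
connect sum is a single circle exactly when neither summand has a closed component and the patterns
`(m₁, m₂)` fit. For `+_h` the numerator needs `m₁ ≠ m₂` and the denominator needs `m₁ = m₂ = 1`; for
`+_v` the two closures swap roles, with `0` in place of `1`. Weights of states multiply, so the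
brackets of the sum are bilinear in those of the summands. The powers of `i` in the bracket matrix
turn this into the stated columns up to an eighth root of unity, and integrality leaves only a sign.
The topological input is that the two arcs do not cross (`exists_mate`), although planarity is given
only as an Euler count. That count makes the homology mod 2 vanish and, all vertices being even,
yields a checkerboard colouring (`exists_checkerboard`). The colour changes at each step along an
arc of a resolution, so the two ends of the arc have opposite colours; colours alternate around the
outer circle, so opposite outer points are never joined. Components are handled throughout through
the `Bool`-valued functions constant on them, which transport easily along closures and gluings. -/

namespace PBT

/-! ### Checkerboard colourings of planar diagrams -/

section Checkerboard

variable {D : Type} [Fintype D]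

/-- The coboundary, over the field with two elements, of a function on the ends, with respect to
two maps on the ends. -/
def coboundary (a n : D → D) : (D → ZMod 2) →ₗ[ZMod 2] (D → ZMod 2) × (D → ZMod 2) where
  toFun c := (c ∘ a - c, c ∘ n - c)
  map_add' c c' := by
    ext x <;> simp <;> ring
  map_smul' r c := by
    ext x <;> simp <;> ring

theorem finrank_ker_coboundary_le (a n : D → D) :
    Module.finrank (ZMod 2) (LinearMap.ker (coboundary a n)) ≤
      Nat.card (Quot fun x y : D => y = a x ∨ y = n x) := by
  classical
  let Q := Quot fun x y : D => y = a x ∨ y = n x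
  let pull : (Q → ZMod 2) →ₗ[ZMod 2] (D → ZMod 2) := LinearMap.funLeft _ _ (Quot.mk _)
  have : Fintype Q := Fintype.ofFinite Q
  have hle : LinearMap.ker (coboundary a n) ≤ LinearMap.range pull := by
    intro c hc
    have h1 : c ∘ a - c = 0 := congrArg Prod.fst (LinearMap.mem_ker.1 hc)
    have h2 : c ∘ n - c = 0 := congrArg Prod.snd (LinearMap.mem_ker.1 hc)
    refine ⟨Quot.lift c ?_, rfl⟩
    rintro x y (rfl | rfl)
    · exact (sub_eq_zero.1 (congrFun h1 x)).symm
    · exact (sub_eq_zero.1 (congrFun h2 x)).symm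
  calc _ ≤ Module.finrank (ZMod 2) (LinearMap.range pull) := Submodule.finrank_mono hle
    _ ≤ Module.finrank (ZMod 2) (Q → ZMod 2) := LinearMap.finrank_range_le _
    _ = Nat.card Q := by rw [Module.finrank_fintype_fun_eq_card, Nat.card_eq_fintype_card]

/-- Functions on edges, vertices and faces, as linear forms on pairs of functions on the ends. -/
def cycleForm (a n : D → D) :
    ((Quot fun x y : D => y = a x) → ZMod 2) × ((Quot fun x y : D => y = n x) → ZMod 2) ×
      ((Quot fun x y : D => y = n (a x)) → ZMod 2) →ₗ[ZMod 2]
      Module.Dual (ZMod 2) ((D → ZMod 2) × (D → ZMod 2)) :=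
  LinearMap.mk₂ (ZMod 2)
    (fun w u => ∑ x, ((w.1 (Quot.mk _ x) + w.2.2 (Quot.mk _ x)) * u.1 x +
      (w.2.1 (Quot.mk _ x) + w.2.2 (Quot.mk _ (a x))) * u.2 x))
    (fun w w' u => by
      rw [← Finset.sum_add_distrib]; refine Finset.sum_congr rfl fun x _ => ?_
      simp only [Prod.fst_add, Prod.snd_add, Pi.add_apply]; ring)
    (fun r w u => by
      rw [Finset.smul_sum]; refine Finset.sum_congr rfl fun x _ => ?_
      simp only [Prod.smul_fst, Prod.smul_snd, Pi.smul_apply, smul_eq_mul]; ring)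
    (fun w u u' => by
      rw [← Finset.sum_add_distrib]; refine Finset.sum_congr rfl fun x _ => ?_
      simp only [Prod.fst_add, Prod.snd_add, Pi.add_apply]; ring)
    (fun r w u => by
      rw [Finset.smul_sum]; refine Finset.sum_congr rfl fun x _ => ?_
      simp only [Prod.smul_fst, Prod.smul_snd, Pi.smul_apply, smul_eq_mul]; ring)

theorem cycleForm_apply (a n : D → D) (w) (u : (D → ZMod 2) × (D → ZMod 2)) :
    cycleForm a n w u = ∑ x, ((w.1 (Quot.mk _ x) + w.2.2 (Quot.mk _ x)) * u.1 x +
      (w.2.1 (Quot.mk _ x) + w.2.2 (Quot.mk _ (a x))) * u.2 x) := rfl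

/-- Testing a vanishing form on indicator functions expresses the edge and vertex functions through
the face function, which is then itself constant on connected components. -/
theorem finrank_ker_cycleForm_le (a n : D → D) :
    Module.finrank (ZMod 2) (LinearMap.ker (cycleForm a n)) ≤
      Nat.card (Quot fun x y : D => y = a x ∨ y = n x) := by
  classical
  let Q := Quot fun x y : D => y = a x ∨ y = n x
  have : Fintype Q := Fintype.ofFinite Q
  let pull : (Q → ZMod 2) →ₗ[ZMod 2]
      ((Quot fun x y : D => y = a x) → ZMod 2) × ((Quot fun x y : D => y = n x) → ZMod 2) ×
        ((Quot fun x y : D => y = n (a x)) → ZMod 2) :=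
    (LinearMap.funLeft _ _ (Quot.lift (Quot.mk _) fun x y h => Quot.sound (Or.inl h))).prod
      ((LinearMap.funLeft _ _ (Quot.lift (Quot.mk _) fun x y h => Quot.sound (Or.inr h))).prod
        (LinearMap.funLeft _ _ (Quot.lift (Quot.mk _) fun x y h =>
          (Quot.sound (r := fun x y : D => y = a x ∨ y = n x) (Or.inl (rfl : a x = a x))).trans
            (Quot.sound (Or.inr h)))))
  have hle : LinearMap.ker (cycleForm a n) ≤ LinearMap.range pull := by
    rintro ⟨α, β, γ⟩ hw
    have hw := LinearMap.mem_ker.1 hw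
    have h1 (x : D) : α (Quot.mk _ x) = γ (Quot.mk _ x) := by
      have := DFunLike.congr_fun hw (Pi.single x 1, 0)
      simp only [cycleForm_apply, Pi.zero_apply, mul_zero, add_zero, LinearMap.zero_apply] at this
      rw [Finset.sum_eq_single x (fun y _ hy => by simp [hy]) (by simp)] at this
      simpa using CharTwo.add_eq_zero.1 (by simpa using this)
    have h2 (x : D) : β (Quot.mk _ x) = γ (Quot.mk _ (a x)) := by
      have := DFunLike.congr_fun hw (0, Pi.single x 1)
      simp only [cycleForm_apply, Pi.zero_apply, mul_zero, zero_add, LinearMap.zero_apply] at this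
      rw [Finset.sum_eq_single x (fun y _ hy => by simp [hy]) (by simp)] at this
      simpa using CharTwo.add_eq_zero.1 (by simpa using this)
    have ha (x : D) : γ (Quot.mk _ (a x)) = γ (Quot.mk _ x) := by
      rw [← h1, ← h1, Quot.sound (r := fun x y : D => y = a x) (rfl : a x = a x)]
    have hn (x : D) : γ (Quot.mk _ (n x)) = γ (Quot.mk _ x) := by
      rw [← ha (n x), ← ha x, ← h2, ← h2,
        Quot.sound (r := fun x y : D => y = n x) (rfl : n x = n x)]
    refine ⟨Quot.lift (fun x => γ (Quot.mk _ x)) ?_, ?_⟩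
    · rintro x y (rfl | rfl)
      · exact (ha x).symm
      · exact (hn x).symm
    · refine Prod.ext (funext fun q => ?_) (Prod.ext (funext fun q => ?_) (funext fun q => ?_)) <;>
        induction q using Quot.ind with | _ x => ?_
      · exact (h1 x).symm
      · exact (ha x).symm.trans (h2 x).symm
      · rfl
  calc _ ≤ Module.finrank (ZMod 2) (LinearMap.range pull) := Submodule.finrank_mono hle
    _ ≤ Module.finrank (ZMod 2) (Q → ZMod 2) := LinearMap.finrank_range_le _
    _ = Nat.card Q := by rw [Module.finrank_fintype_fun_eq_card, Nat.card_eq_fintype_card]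

/-- Edges, vertices and faces give closed walks, along which the increments of a function add up to
zero. -/
theorem range_cycleForm_le (a n : D → D) (haa : ∀ x, a (a x) = x) (hn : Function.Injective n) :
    LinearMap.range (cycleForm a n) ≤ (LinearMap.range (coboundary a n)).dualAnnihilator := by
  rintro _ ⟨⟨α, β, γ⟩, rfl⟩
  rw [Submodule.mem_dualAnnihilator]
  rintro _ ⟨c, rfl⟩
  have ea : Function.Bijective a := Function.Involutive.bijective haa
  have en : Function.Bijective n := Finite.injective_iff_bijective.1 hn
  have hα : ∑ x, α (Quot.mk _ x) * c (a x) = ∑ x, α (Quot.mk _ x) * c x := by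
    rw [← ea.sum_comp fun x => α (Quot.mk _ x) * c x]
    refine Finset.sum_congr rfl fun x _ => ?_
    rw [Quot.sound (r := fun x y : D => y = a x) (rfl : a x = a x)]
  have hβ : ∑ x, β (Quot.mk _ x) * c (n x) = ∑ x, β (Quot.mk _ x) * c x := by
    rw [← en.sum_comp fun x => β (Quot.mk _ x) * c x]
    refine Finset.sum_congr rfl fun x _ => ?_
    rw [Quot.sound (r := fun x y : D => y = n x) (rfl : n x = n x)]
  have hγ : ∑ x, γ (Quot.mk _ x) * c (a x) = ∑ x, γ (Quot.mk _ (a x)) * c x := by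
    rw [← ea.sum_comp fun x => γ (Quot.mk _ x) * c (a x)]
    simp only [haa]
  have hγ' : ∑ x, γ (Quot.mk _ (a x)) * c (n x) = ∑ x, γ (Quot.mk _ x) * c x := by
    rw [← ea.sum_comp fun x => γ (Quot.mk _ (a x)) * c (n x),
      ← (en.comp ea).sum_comp fun x => γ (Quot.mk _ x) * c x]
    refine Finset.sum_congr rfl fun x _ => ?_
    rw [haa, Function.comp_apply,
      Quot.sound (r := fun x y : D => y = n (a x)) (rfl : n (a x) = n (a x))]
  simp only [cycleForm_apply, coboundary, LinearMap.coe_mk, AddHom.coe_mk, Pi.sub_apply,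
    Function.comp_apply, add_mul, mul_sub, Finset.sum_add_distrib, Finset.sum_sub_distrib,
    hα, hβ, hγ, hγ']
  ring

theorem card_le_two_mul_card_quot (a : D → D) (haa : ∀ x, a (a x) = x) :
    Fintype.card D ≤ 2 * Nat.card (Quot fun x y : D => y = a x) := by
  classical
  let Q := Quot fun x y : D => y = a x
  have : Fintype Q := Fintype.ofFinite Q
  rw [Nat.card_eq_fintype_card, ← Finset.card_univ, ← Finset.card_univ]
  refine Finset.card_le_mul_card_image_of_maps_to (f := Quot.mk _) (fun _ _ => Finset.mem_univ _)
    2 fun q _ => ?_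
  induction q using Quot.ind with | _ x => ?_
  refine (Finset.card_le_card (t := {x, a x}) fun y hy => ?_).trans Finset.card_le_two
  have hxy : Quot.mk (fun x y : D => y = a x) y = Quot.mk _ x := by simpa using hy
  let f : Q → Prop := Quot.lift (fun y => y = x ∨ y = a x) fun u v h => by
    subst h
    refine propext ⟨?_, ?_⟩
    · rintro (rfl | rfl)
      · exact Or.inr rfl
      · exact Or.inl (haa x)
    · rintro (h | h)
      · exact Or.inr (by rw [← h, haa])
      · exact Or.inl (by rw [← haa u, h, haa])
  have : f (Quot.mk _ y) := by
    rw [hxy]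
    exact Or.inl rfl
  simpa [f] using this

/-- On a union of combinatorial spheres all of whose vertices have even degree, the corners can be
coloured like a checkerboard. -/
theorem exists_checkerboard (a n ρ : D → D) (haa : ∀ x, a (a x) = x) (ha : ∀ x, a x ≠ x)
    (hn : Function.Injective n) (hρρ : ∀ x, ρ (ρ x) = x) (hρ : ∀ x, ρ x ≠ x)
    (hρn : ∀ x, ρ x = n x ∨ ρ x = n (n x))
    (euler : Nat.card (Quot fun x y : D => y = n x) + Nat.card (Quot fun x y : D => y = n (a x)) =
      Nat.card (Quot fun x y : D => y = a x) +
        2 * Nat.card (Quot fun x y : D => y = a x ∨ y = n x)) :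
    ∃ c : D → ZMod 2, (∀ x, c (a x) = c x + 1) ∧ ∀ x, c (n x) = c x + 1 := by
  classical
  have hrange : LinearMap.range (cycleForm a n) =
      (LinearMap.range (coboundary a n)).dualAnnihilator := by
    -- With `V, E, F, K` vertices, edges, faces and components, the annihilator has dimension at
    -- most `|D| + K` and the range at least `V + E + F - K`. By Euler's formula the latter is `2E +
    -- K`, and `|D| ≤ 2E`.
    refine Submodule.eq_of_le_of_finrank_le (range_cycleForm_le a n haa hn) ?_
    have h1 := Subspace.finrank_add_finrank_dualAnnihilator_eq (LinearMap.range (coboundary a n))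
    have h2 := (coboundary a n).finrank_range_add_finrank_ker
    have h3 := (cycleForm a n).finrank_range_add_finrank_ker
    have h4 := finrank_ker_coboundary_le a n
    have h5 := finrank_ker_cycleForm_le a n
    have h6 := card_le_two_mul_card_quot a haa
    have : Fintype (Quot fun x y : D => y = a x) := Fintype.ofFinite _
    have : Fintype (Quot fun x y : D => y = n x) := Fintype.ofFinite _
    have : Fintype (Quot fun x y : D => y = n (a x)) := Fintype.ofFinite _
    simp only [Module.finrank_prod, Module.finrank_fintype_fun_eq_card] at h1 h2 h3
    simp only [← Nat.card_eq_fintype_card] at h1 h2 h3 h6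
    omega
  -- A checkerboard colouring is a preimage of `(1, 1)`. It exists because each edge has two ends,
  -- each vertex has even degree (`ρ` pairs its ends), and a face boundary alternates steps `a` and
  -- `n`, so its length is even.
  have hmem : ((1, 1) : (D → ZMod 2) × (D → ZMod 2)) ∈ LinearMap.range (coboundary a n) := by
    rw [← Subspace.forall_mem_dualAnnihilator_apply_eq_zero_iff, ← hrange]
    rintro _ ⟨⟨α, β, γ⟩, rfl⟩
    have ea : Function.Bijective a := Function.Involutive.bijective haa
    have hα : ∑ x, α (Quot.mk _ x) = 0 :=
      Finset.sum_involution (fun x _ => a x)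
        (fun x _ => by
          rw [Quot.sound (r := fun x y : D => y = a x) (rfl : a x = a x)]
          exact CharTwo.add_self_eq_zero _)
        (fun x _ _ => ha x) (fun _ _ => Finset.mem_univ _) (fun x _ => haa x)
    have hβ : ∑ x, β (Quot.mk _ x) = 0 := by
      refine Finset.sum_involution (fun x _ => ρ x) (fun x _ => ?_)
        (fun x _ _ => hρ x) (fun _ _ => Finset.mem_univ _) (fun x _ => hρρ x)
      have step (x : D) : Quot.mk (fun x y : D => y = n x) x = Quot.mk _ (n x) := Quot.sound rfl
      have : Quot.mk (fun x y : D => y = n x) (ρ x) = Quot.mk _ x := by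
        rcases hρn x with h | h
        · rw [h, ← step]
        · rw [h, ← step, ← step]
      rw [this]
      exact CharTwo.add_self_eq_zero _
    have hγ : ∑ x, γ (Quot.mk _ (a x)) = ∑ x, γ (Quot.mk _ x) :=
      ea.sum_comp fun x => γ (Quot.mk _ x)
    simp only [cycleForm_apply, Pi.one_apply, mul_one, Finset.sum_add_distrib, hα, hβ, hγ, zero_add]
    exact CharTwo.add_self_eq_zero _
  obtain ⟨c, hc⟩ := hmem
  refine ⟨c, fun x => ?_, fun x => ?_⟩
  · have : c (a x) - c x = 1 := congrFun (congrArg Prod.fst hc) x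
    rw [← this]; ring
  · have : c (n x) - c x = 1 := congrFun (congrArg Prod.snd hc) x
    rw [← this]; ring

end Checkerboard

instance {C P B : Type} [Finite C] [Finite P] [Finite B] : Finite (HalfEdge C P B) :=
  Finite.of_injective
    (fun x : HalfEdge C P B => match x with
      | .crossing c i => (.inl (c, i) : (C × Fin 4) ⊕ (P × Fin 2) ⊕ (B × Fin 4))
      | .point p i => .inr (.inl (p, i))
      | .boundary b i => .inr (.inr (b, i)))
    (by rintro (_ | _ | _) (_ | _ | _) <;> simp)

theorem TangleDiagram.next_injective {n : ℕ} (T : TangleDiagram n) :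
    Function.Injective T.next := by
  rintro (_ | _ | ⟨_ | _, _⟩) (_ | _ | ⟨_ | _, _⟩) <;> simp [TangleDiagram.next]

/-- The regions of a planar tangle diagram admit a checkerboard colouring. -/
theorem TangleDiagram.IsPlanar.exists_coloring {n : ℕ} {T : TangleDiagram n} (hT : T.IsPlanar) :
    ∃ c : T.Ends → ZMod 2, (∀ x, c (T.arc x) = c x + 1) ∧ ∀ x, c (T.next x) = c x + 1 := by
  have : Fintype T.Ends := Fintype.ofFinite _
  let ρ : T.Ends → T.Ends
    | .crossing c i => .crossing c (i + 2)
    | .point p i => .point p (i + 1)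
    | .boundary b i => .boundary b (i + 2)
  have h4 : ∀ i : Fin 4, i + 2 = i + 1 + 1 ∧ i + 2 = i - 1 - 1 := by decide
  have h4' : ∀ i : Fin 4, i + 2 + 2 = i ∧ ¬i + 2 = i := by decide
  have h2 : ∀ i : Fin 2, i + 1 + 1 = i ∧ ¬i + 1 = i := by decide
  refine exists_checkerboard T.arc T.next ρ T.arc_arc T.arc_ne T.next_injective ?_ ?_ ?_ hT
  · rintro (⟨_, i⟩ | ⟨_, i⟩ | ⟨_ | _, i⟩) <;> simp only [ρ, h4', h2]
  · rintro (⟨_, i⟩ | ⟨_, i⟩ | ⟨_ | _, i⟩) <;> simp only [ρ, ne_eq, HalfEdge.crossing.injEq,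
      HalfEdge.point.injEq, HalfEdge.boundary.injEq, true_and, h4', h2, not_false_eq_true]
  · rintro (⟨_, i⟩ | ⟨_, i⟩ | ⟨_ | _, i⟩)
    · exact Or.inr (congrArg _ (h4 i).1)
    · exact Or.inl rfl
    · exact Or.inr (congrArg _ (h4 i).2)
    · exact Or.inr (congrArg _ (h4 i).1)

/-! ### Paths in a resolution -/

/-- The point of the circle that is joined to a given one in `matching`. -/
def mate (m : Fin 2) (i : Fin 4) : Fin 4 :=
  matching m (((matching m).symm i).1, ((matching m).symm i).2.rev)

/-- A split crossing behaves like a hole filled with a fundamental tangle, so one argument serves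
both. -/
theorem split_eq_mate (b : Bool) (i : Fin 4) : split b i = mate (if b then 1 else 0) i := by
  revert b i; decide

theorem mate_parity (m : Fin 2) (i : Fin 4) : mate m i = i + 1 ∨ mate m i = i - 1 := by
  revert m i; decide

theorem mate_mate (m : Fin 2) (i : Fin 4) : mate m (mate m i) = i := by
  revert m i; decide

section Paths

variable {X : Type} {a J : X → X}

/-- A path that alternates between two involutions has at most two ends. -/
theorem exists_invariant_ne (haa : ∀ x, a (a x) = x) (hJJ : ∀ x, J (J x) = x) {x y z : X}
    (hx : J x = x) (hy : J y = y) (hz : J z = z) (hxy : y ≠ x) (hxz : z ≠ x) (hyz : y ≠ z) :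
    ∃ f : X → Bool, (∀ x, f (a x) = f x) ∧ (∀ x, f (J x) = f x) ∧ ¬(f y = f x ∧ f z = f x) := by
  classical
  let j : Equiv.Perm X := ⟨J, J, hJJ, hJJ⟩
  -- Two involutions generate a dihedral action: conjugation by `J` inverts `p = J ∘ a`. The
  -- function sought is the indicator of the `p`-orbit of `x`.
  let p : Equiv.Perm X := j * ⟨a, a, haa, haa⟩
  have hp (x : X) : p x = J (a x) := rfl
  have hjp : j * p * j⁻¹ = p⁻¹ := by
    ext x
    show J (J (a (J x))) = a (J x)
    rw [hJJ]
  have hJp (k : ℤ) {x : X} (hx : J x = x) : J ((p ^ k) x) = (p ^ (-k)) x := by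
    have h : j * p ^ k * j⁻¹ = p ^ (-k) := by rw [← conj_zpow, hjp, inv_zpow']
    have := DFunLike.congr_fun h x
    simp only [Equiv.Perm.mul_apply] at this
    rw [← this, show j⁻¹ x = x from hx]
    rfl
  have hfix {k : ℤ} {y : X} (hk : (p ^ k) x = y) (hy : J y = y) :
      (Function.minimalPeriod (p • ·) x : ℤ) ∣ 2 * k := by
    rw [← MulAction.zpow_smul_eq_iff_minimalPeriod_dvd, two_mul, zpow_add, Equiv.Perm.smul_def,
      Equiv.Perm.mul_apply, hk]
    nth_rw 1 [← hy, ← hk, hJp k hx]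
    rw [← Equiv.Perm.mul_apply, ← zpow_add, add_neg_cancel, zpow_zero, Equiv.Perm.one_apply]
  have hfJ (u : X) : p.SameCycle x u → p.SameCycle x (J u) := by
    rintro ⟨k, rfl⟩
    exact ⟨-k, (hJp k hx).symm⟩
  have hfp (u : X) : p.SameCycle x (p u) ↔ p.SameCycle x u := Equiv.Perm.sameCycle_apply_right
  have hJ (u : X) : p.SameCycle x (J u) ↔ p.SameCycle x u :=
    ⟨fun h => by simpa only [hJJ] using hfJ _ h, hfJ u⟩
  refine ⟨fun u => decide (p.SameCycle x u), fun u => ?_, fun u => ?_, ?_⟩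
  · refine decide_eq_decide.2 ?_
    rw [← hfp u, hp, hJ]
  · exact decide_eq_decide.2 (hJ u)
  · simp only [Equiv.Perm.SameCycle.refl, decide_true, decide_eq_true_eq, not_and]
    rintro ⟨k, hk⟩ ⟨l, hl⟩
    have h1 := hfix hk hy
    have h2 := hfix hl hz
    have h3 : ¬(Function.minimalPeriod (p • ·) x : ℤ) ∣ k := by
      rw [← MulAction.zpow_smul_eq_iff_minimalPeriod_dvd]
      exact fun h => hxy (hk.symm.trans h)
    have h4 : ¬(Function.minimalPeriod (p • ·) x : ℤ) ∣ l := by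
      rw [← MulAction.zpow_smul_eq_iff_minimalPeriod_dvd]
      exact fun h => hxz (hl.symm.trans h)
    -- If `y = p ^ k x` and `z = p ^ l x`, then `k` and `l` are both odd multiples of half the
    -- period, so their difference is a multiple of the period and `y = z`.
    have h5 : ¬(Function.minimalPeriod (p • ·) x : ℤ) ∣ k - l := by
      rw [← MulAction.zpow_smul_eq_iff_minimalPeriod_dvd]
      intro h
      refine hyz (hk.symm.trans (Eq.trans ?_ hl))
      rw [show k = l + (k - l) by ring, zpow_add, Equiv.Perm.mul_apply]
      exact congrArg _ h
    generalize (Function.minimalPeriod (p • ·) x : ℤ) = N at *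
    obtain ⟨u, hu⟩ := h1
    obtain ⟨v, hv⟩ := h2
    rcases Int.even_or_odd' u with ⟨u', rfl | rfl⟩
    · exact h3 ⟨u', by linarith⟩
    rcases Int.even_or_odd' v with ⟨v', rfl | rfl⟩
    · exact h4 ⟨v', by linarith⟩
    exact h5 ⟨u' - v', by linarith⟩

/-- Signed count of the ends of a union of components of a resolution. -/
theorem sum_ends_eq_zero [Fintype X] (haa : ∀ x, a (a x) = x) (hJJ : ∀ x, J (J x) = x)
    {o : Fin 4 → X} (ho : Function.Injective o) (hJo : ∀ i, J (o i) = o i)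
    {c : X → ZMod 2} (hca : ∀ x, c (a x) = c x + 1)
    (hcJ : ∀ x, x ∉ Set.range o → c (J x) = c x + 1)
    (hco : ∀ i, c (o (i + 1)) = c (o i) + 1)
    {f : X → ℤ} (hfa : ∀ x, f (a x) = f x) (hfJ : ∀ x, f (J x) = f x) :
    f (o 0) + f (o 2) = f (o 1) + f (o 3) := by
  classical
  let s : ZMod 2 → ℤ := ![1, -1]
  have hs : ∀ t, s (t + 1) = -s t := by decide
  -- The signs cancel in pairs along `a` over all ends, and along `J` over all but the four outer
  -- ends, so the outer terms sum to zero by themselves.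
  have h1 : ∑ x, s (c x) * f x = 0 := by
    have h : ∑ x, s (c x) * f x = ∑ x, -(s (c x) * f x) := by
      rw [← (Function.Involutive.bijective haa).sum_comp]
      exact Finset.sum_congr rfl fun x _ => by rw [hca, hs, hfa]; ring
    rw [Finset.sum_neg_distrib] at h
    linarith
  let S : Finset X := Finset.univ.image o
  have hS (x : X) : x ∈ S ↔ x ∈ Set.range o := by simp [S]
  have hJS (x : X) : J x ∈ S ↔ x ∈ S := by
    have (x : X) (hx : x ∈ S) : J x ∈ S := by
      obtain ⟨i, rfl⟩ := (hS x).1 hx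
      rwa [hJo]
    exact ⟨fun h => by simpa only [hJJ] using this _ h, this x⟩
  have h2 : ∑ x ∈ Sᶜ, s (c x) * f x = 0 := by
    have h : ∑ x ∈ Sᶜ, s (c x) * f x = ∑ x ∈ Sᶜ, -(s (c x) * f x) := by
      refine Finset.sum_bij (fun x _ => J x) (fun x hx => ?_)
        (fun x _ y _ h => (Function.Involutive.bijective hJJ).1 h)
        (fun x hx => ⟨J x, ?_, hJJ x⟩) (fun x hx => ?_)
      · simpa [hJS] using hx
      · simpa [hJS] using hx
      · rw [hcJ x ((hS x).not.1 (Finset.mem_compl.1 hx)), hs, hfJ]; ring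
    rw [Finset.sum_neg_distrib] at h
    linarith
  have h3 : ∑ i, s (c (o i)) * f (o i) = 0 := by
    rw [← Finset.sum_compl_add_sum S, h2, zero_add, Finset.sum_image ho.injOn] at h1
    exact h1
  have e1 : s (c (o 1)) = -s (c (o 0)) := by rw [← hs, ← hco]; rfl
  have e2 : s (c (o 2)) = s (c (o 0)) := by
    rw [show s (c (o 2)) = -s (c (o 1)) by rw [← hs, ← hco]; rfl, e1, neg_neg]
  have e3 : s (c (o 3)) = -s (c (o 0)) := by
    rw [show s (c (o 3)) = -s (c (o 2)) by rw [← hs, ← hco]; rfl, e2]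
  have hs0 (t) : s t = 1 ∨ s t = -1 := by
    fin_cases t
    · exact Or.inl rfl
    · exact Or.inr rfl
  rw [Fin.sum_univ_four, e1, e2, e3] at h3
  rcases hs0 (c (o 0)) with h | h <;> rw [h] at h3 <;> linarith

set_option synthInstance.maxHeartbeats 200000 in
set_option synthInstance.maxSize 1024 in
/-- The four ends of a resolution with a checkerboard colouring are joined without crossings. -/
theorem exists_mate [Fintype X] (haa : ∀ x, a (a x) = x) (hJJ : ∀ x, J (J x) = x)
    {o : Fin 4 → X} (ho : Function.Injective o) (hJo : ∀ i, J (o i) = o i)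
    {c : X → ZMod 2} (hca : ∀ x, c (a x) = c x + 1)
    (hcJ : ∀ x, x ∉ Set.range o → c (J x) = c x + 1)
    (hco : ∀ i, c (o (i + 1)) = c (o i) + 1) :
    ∃ m : Fin 2, ∀ g : Fin 4 → Bool,
      (∃ f : X → Bool, (∀ x, f (a x) = f x) ∧ (∀ x, f (J x) = f x) ∧ ∀ i, f (o i) = g i) ↔
        ∀ i, g (mate m i) = g i := by
  -- `R` is a Boolean algebra of functions on the outer ends, each satisfying the balance of
  -- `sum_ends_eq_zero`.
  let R : Set (Fin 4 → Bool) := {g |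
    ∃ f : X → Bool, (∀ x, f (a x) = f x) ∧ (∀ x, f (J x) = f x) ∧ ∀ i, f (o i) = g i}
  have hR {g} (hg : g ∈ R) : (if g 0 then 1 else 0 : ℤ) + (if g 2 then 1 else 0) =
      (if g 1 then 1 else 0) + (if g 3 then 1 else 0) := by
    obtain ⟨f, hfa, hfJ, hfo⟩ := hg
    simp only [← hfo]
    exact sum_ends_eq_zero haa hJJ ho hJo hca hcJ hco (f := fun x => if f x then 1 else 0)
      (fun x => by rw [hfa]) (fun x => by rw [hfJ])
  have hop (u : Bool → Bool → Bool) {g g'} (hg : g ∈ R) (hg' : g' ∈ R) :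
      (fun i => u (g i) (g' i)) ∈ R := by
    obtain ⟨f, hfa, hfJ, hfo⟩ := hg
    obtain ⟨f', hfa', hfJ', hfo'⟩ := hg'
    exact ⟨fun x => u (f x) (f' x), fun x => by simp only [hfa, hfa'],
      fun x => by simp only [hfJ, hfJ'], fun i => by simp only [hfo, hfo']⟩
  obtain ⟨f, hfa, hfJ, hf⟩ := exists_invariant_ne haa hJJ (hJo 0) (hJo 1) (hJo 2)
    (ho.ne (by decide)) (ho.ne (by decide)) (ho.ne (by decide))
  let e : Fin 4 → Bool := fun i => f (o i)
  have he : e ∈ R := ⟨f, hfa, hfJ, fun _ => rfl⟩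
  have hne : ¬(e 1 = e 0 ∧ e 2 = e 0) := hf
  -- A nonconstant balanced `e` takes each value on two neighbouring ends, hence singles out a
  -- matching and has `e 0 ≠ e 2`.
  have hm : ∃ m, ∀ i, e (mate m i) = e i := by
    have := hR he
    generalize e = e at this hne
    revert e; decide
  obtain ⟨m, hm⟩ := hm
  refine ⟨m, fun g => ⟨fun hg => ?_, fun hg => ?_⟩⟩
  -- Balance of the part of `g` on each of the two pairs forces `g` to be constant on that pair.
  -- Conversely, such a `g` is a function of `e`.
  · have h1 := hR (hop (fun x y => x && y) hg he)
    have h2 := hR (hop (fun x y => x && !y) hg he)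
    have h3 := hR he
    generalize e = e at h1 h2 h3 hne hm
    clear hR hop hg
    revert m g e; decide
  · let u : Bool → Bool → Bool := fun t _ => if t = e 0 then g 0 else g 2
    have : g = fun i => u (e i) (e i) := by
      simp only [u]
      clear u
      generalize e = e at hne hm
      clear hR hop
      revert m g e; decide
    change g ∈ R
    rw [this]
    exact hop u he he

end Paths

/-! ### Counting the circles of a resolution -/

/-- If two ends lie on different circles, the indicator of one circle separates them. -/
theorem LinkDiagram.circles_eq_one_iff (L : LinkDiagram) [Nonempty L.Ends] (σ : L.State) :
    L.circles σ = 1 ↔ ∀ f : L.Ends → Bool, (∀ x, f (L.arc x) = f x) →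
      (∀ x, f (L.join σ x) = f x) → ∀ x y, f x = f y := by
  classical
  rw [LinkDiagram.circles, Nat.card_eq_one_iff_unique]
  refine ⟨fun ⟨h, _⟩ f ha hj x y => ?_,
    fun h => ⟨⟨fun u v => ?_⟩, Nonempty.map (Quot.mk _) inferInstance⟩⟩
  · let F : (Quot fun x y : L.Ends => y = L.arc x ∨ y = L.join σ x) → Bool :=
      Quot.lift f (by
        rintro x y (rfl | rfl)
        · exact (ha x).symm
        · exact (hj x).symm)
    exact congrArg F (h.elim (Quot.mk _ x) (Quot.mk _ y))
  · induction u using Quot.ind with | _ x => ?_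
    induction v using Quot.ind with | _ y => ?_
    let q : L.Ends → Quot fun x y : L.Ends => y = L.arc x ∨ y = L.join σ x := Quot.mk _
    have ha (z) : q (L.arc z) = q z :=
      (Quot.sound (r := fun x y : L.Ends => y = L.arc x ∨ y = L.join σ x) (Or.inl rfl)).symm
    have hj (z) : q (L.join σ z) = q z :=
      (Quot.sound (r := fun x y : L.Ends => y = L.arc x ∨ y = L.join σ x) (Or.inr rfl)).symm
    have := h (fun z => decide (q z = q x)) (fun z => by rw [ha]) (fun z => by rw [hj]) x y
    exact (of_decide_eq_true (this.symm.trans (decide_eq_true rfl))).symm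

theorem LinkDiagram.zero_pow_circles (L : LinkDiagram) [Nonempty L.Ends] (σ : L.State) :
    (0 : ℂ) ^ (L.circles σ - 1) = by classical exact if L.circles σ = 1 then 1 else 0 := by
  have : Nonempty (Quot fun x y : L.Ends => y = L.arc x ∨ y = L.join σ x) :=
    Nonempty.map (Quot.mk _) inferInstance
  -- Positivity matters: with truncated subtraction, zero circles would also give `0 ^ 0 = 1`.
  have : 0 < L.circles σ := Nat.card_pos
  rw [zero_pow_eq]
  exact if_congr (by omega) rfl rfl

namespace TangleDiagram

variable {n : ℕ} (T : TangleDiagram n)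

/-- In the resolution of a tangle diagram with filled holes, an end at a crossing, at a bivalent
point or at a hole continues in another end there. -/
def partialJoin (σ : T.Crossing → Bool) (α : Fin n → Fin 2) : T.Ends → T.Ends
  | .crossing c i => .crossing c (split (σ c) i)
  | .point p i => .point p i.rev
  | .boundary (some k) i => .boundary (some k) (mate (α k) i)
  | .boundary none i => .boundary none i

/-- The functions that are constant on the components of a resolution. -/
def IsLocallyConstant (σ : T.Crossing → Bool) (α : Fin n → Fin 2) (f : T.Ends → Bool) : Prop :=
  (∀ x, f (T.arc x) = f x) ∧ ∀ x, f (T.partialJoin σ α x) = f x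

/-- The restriction of a function to the outer circle. -/
def outer (f : T.Ends → Bool) (i : Fin 4) : Bool := f (.boundary none i)

/-- Every component of a resolution meets the outer circle. -/
def NoClosedComponent (σ : T.Crossing → Bool) (α : Fin n → Fin 2) : Prop :=
  ∀ f, T.IsLocallyConstant σ α f → (∀ i, T.outer f i = false) → ∀ x, f x = false

variable {T}

theorem IsLocallyConstant.map {σ α} {f : T.Ends → Bool} (h : T.IsLocallyConstant σ α f)
    (u : Bool → Bool) : T.IsLocallyConstant σ α fun x => u (f x) :=
  ⟨fun x => congrArg u (h.1 x), fun x => congrArg u (h.2 x)⟩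

theorem isLocallyConstant_const {σ α} (b : Bool) : T.IsLocallyConstant σ α fun _ => b :=
  ⟨fun _ => rfl, fun _ => rfl⟩

theorem NoClosedComponent.eq_const {σ α} (h : T.NoClosedComponent σ α) {f : T.Ends → Bool}
    (hf : T.IsLocallyConstant σ α f) {b : Bool} (hb : ∀ i, T.outer f i = b) (x : T.Ends) :
    f x = b := by
  have := h (fun x => xor b (f x)) (hf.map _) (fun i => by
    have := hb i
    simp only [outer] at this ⊢
    rw [this, Bool.xor_self]) x
  revert this
  cases b <;> cases f x <;> simp

/-- Filling the holes of a planar tangle diagram and splitting its crossings leaves two disjoint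
arcs and closed components. -/
theorem IsPlanar.exists_mate (hT : T.IsPlanar) (σ : T.Crossing → Bool) (α : Fin n → Fin 2) :
    ∃ m : Fin 2, ∀ g : Fin 4 → Bool,
      (∃ f, T.IsLocallyConstant σ α f ∧ T.outer f = g) ↔ ∀ i, g (mate m i) = g i := by
  obtain ⟨c, hca, hcn⟩ := hT.exists_coloring
  have : Fintype T.Ends := Fintype.ofFinite _
  have hsplit (m : Fin 2) (u : Fin 4 → ZMod 2) (hu : ∀ i, u (i + 1) = u i + 1) (i : Fin 4) :
      u (mate m i) = u i + 1 := by
    rcases mate_parity m i with h | h <;> rw [h]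
    · exact hu i
    · have := hu (i - 1)
      rw [sub_add_cancel] at this
      rw [this, add_assoc, CharTwo.add_self_eq_zero, add_zero]
  have hout (i : Fin 4) : c (.boundary none (i + 1)) = c (.boundary none i) + 1 := by
    have := hcn (.boundary none (i + 1))
    simp only [next, add_sub_cancel_right] at this
    rw [this, add_assoc, CharTwo.add_self_eq_zero, add_zero]
  obtain ⟨m, hm⟩ := PBT.exists_mate (a := T.arc) (J := T.partialJoin σ α)
    (o := fun i => .boundary none i) T.arc_arc (by
      rintro (⟨_, i⟩ | ⟨_, i⟩ | ⟨_ | _, i⟩) <;>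
        simp [partialJoin, split_eq_mate, mate_mate]) (fun i j h => by simpa using h)
    (fun i => rfl) hca (by
      rintro (⟨k, i⟩ | ⟨p, i⟩ | ⟨_ | k, i⟩) hx
      · rw [partialJoin, split_eq_mate]
        exact hsplit _ (fun i => c (.crossing k i)) (fun i => hcn (.crossing k i)) i
      · have : i.rev = i + 1 := by clear hx; revert i; decide
        rw [partialJoin, this]
        exact hcn (.point p i)
      · exact absurd ⟨i, rfl⟩ hx
      · exact hsplit _ (fun i => c (.boundary (some k) i)) (fun i => hcn (.boundary (some k) i)) i)
    hout
  refine ⟨m, fun g => ?_⟩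
  rw [← hm g]
  simp only [IsLocallyConstant, funext_iff, outer, and_assoc]

instance (i : Fin 2) (α : Fin n → Fin 2) : Nonempty (T.closure i α).Ends :=
  ⟨(closeEnds T.Crossing T.Point fun b => b.elim i.rev α).symm (.boundary none 0)⟩

theorem circles_closure_eq_one_iff (σ : T.Crossing → Bool) (i : Fin 2) (α : Fin n → Fin 2) :
    (T.closure i α).circles σ = 1 ↔ ∀ f, T.IsLocallyConstant σ α f →
      (∀ j, T.outer f (mate i.rev j) = T.outer f j) → ∀ x y, f x = f y := by
  refine ((T.closure i α).circles_eq_one_iff σ).trans ?_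
  let φ : (T.closure i α).Ends ≃ T.Ends := closeEnds T.Crossing T.Point fun b => b.elim i.rev α
  have harc (x) : φ ((T.closure i α).arc x) = T.arc (φ x) := φ.apply_symm_apply _
  have hjoin (f : T.Ends → Bool) : (∀ x, f (φ ((T.closure i α).join σ x)) = f (φ x)) ↔
      (∀ x, f (T.partialJoin σ α x) = f x) ∧ ∀ j, T.outer f (mate i.rev j) = T.outer f j := by
    have hfill (b : Option (Fin n)) (j : Fin 4) :
        φ ((T.closure i α).join σ (φ.symm (.boundary b j))) =
          .boundary b (mate (b.elim i.rev α) j) := rfl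
    constructor
    · intro h
      refine ⟨?_, fun j => ?_⟩
      · rintro (⟨c, j⟩ | ⟨p, j⟩ | ⟨_ | k, j⟩)
        · exact h (.crossing c j)
        · exact h (.point (.inl p) j)
        · rfl
        · have := h (φ.symm (.boundary (some k) j))
          rw [hfill, φ.apply_symm_apply] at this
          exact this
      · have := h (φ.symm (.boundary none j))
        rw [hfill, φ.apply_symm_apply] at this
        exact this
    · rintro ⟨h, ho⟩ x
      obtain ⟨y, rfl⟩ := φ.symm.surjective x
      rw [φ.apply_symm_apply]
      rcases y with ⟨c, j⟩ | ⟨p, j⟩ | ⟨_ | k, j⟩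
      · exact h (.crossing c j)
      · exact h (.point p j)
      · rw [hfill]
        exact ho j
      · rw [hfill]
        exact h (.boundary (some k) j)
  constructor
  · rintro h f ⟨hfa, hfj⟩ ho x y
    have := h (fun z => f (φ z)) (fun z => by rw [harc, hfa]) ((hjoin f).2 ⟨hfj, ho⟩)
      (φ.symm x) (φ.symm y)
    simpa only [φ.apply_symm_apply] using this
  · intro h f hfa hfj x y
    have hf : f = fun z => f (φ.symm (φ z)) := by simp
    obtain ⟨h1, h2⟩ := (hjoin fun z => f (φ.symm z)).1 (by simpa using hfj)
    have := h (fun z => f (φ.symm z)) ⟨fun z => ?_, h1⟩ h2 (φ x) (φ y)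
    · simpa using this
    · have := hfa (φ.symm z)
      rw [← φ.symm_apply_apply ((T.closure i α).arc _), harc, φ.apply_symm_apply] at this
      exact this

/-- A closure of a resolution is one circle if and only if there is no closed component and the two
arcs are not parallel to those of the closure. -/
theorem circles_closure_eq_one_iff_of_mate {σ : T.Crossing → Bool} {α : Fin n → Fin 2} {m : Fin 2}
    (hm : ∀ g : Fin 4 → Bool,
      (∃ f, T.IsLocallyConstant σ α f ∧ T.outer f = g) ↔ ∀ i, g (mate m i) = g i) (i : Fin 2) :
    (T.closure i α).circles σ = 1 ↔ T.NoClosedComponent σ α ∧ m = i := by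
  have key : ∀ m i : Fin 2, m = i ↔ ∀ g : Fin 4 → Bool, (∀ j, g (mate m j) = g j) →
      (∀ j, g (mate i.rev j) = g j) → ∀ j, g j = g 0 := by decide
  refine (circles_closure_eq_one_iff σ i α).trans ?_
  rw [key]
  constructor
  · refine fun h => ⟨fun f hf hf0 x => ?_, fun g hg hg' j => ?_⟩
    · rw [← hf0 0]
      exact h f hf (fun j => by rw [hf0, hf0]) _ _
    · obtain ⟨f, hf, rfl⟩ := (hm g).2 hg
      exact h f hf hg' _ _
  · rintro ⟨h, hg⟩ f hf hf' x y
    have := hg _ ((hm _).1 ⟨f, hf, rfl⟩) hf'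
    rw [h.eq_const hf this, h.eq_const hf this]

/-! ### Resolutions of connect sums -/

variable {k₁ k₂ : ℕ} {T₁ : TangleDiagram k₁} {T₂ : TangleDiagram k₂}

/-- The condition that two functions on the outer circles agree where the tangles are glued. -/
def AgreeOnGlue (g : Fin 4 ⊕ Fin 2 × Fin 2 ≃ Fin 4 ⊕ Fin 4) (u₁ u₂ : Fin 4 → Bool) : Prop :=
  ∀ s e : Fin 2, Sum.elim u₁ u₂ (g (.inr (s, e.rev))) = Sum.elim u₁ u₂ (g (.inr (s, e)))

instance (g : Fin 4 ⊕ Fin 2 × Fin 2 ≃ Fin 4 ⊕ Fin 4) (u₁ u₂ : Fin 4 → Bool) :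
    Decidable (AgreeOnGlue g u₁ u₂) :=
  inferInstanceAs (Decidable (∀ s e : Fin 2,
    Sum.elim u₁ u₂ (g (.inr (s, e.rev))) = Sum.elim u₁ u₂ (g (.inr (s, e)))))

/-- A locally constant function on the glued diagram is a pair of such functions on the summands
that agree across the two gluing points. -/
theorem circles_closure_glue_eq_one_iff (g : Fin 4 ⊕ Fin 2 × Fin 2 ≃ Fin 4 ⊕ Fin 4)
    (σ₁ : T₁.Crossing → Bool) (σ₂ : T₂.Crossing → Bool) (α₁ : Fin k₁ → Fin 2)
    (α₂ : Fin k₂ → Fin 2) (i : Fin 2) :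
    ((TangleDiagram.glue g T₁ T₂).closure i (Sum.elim α₁ α₂ ∘ finSumFinEquiv.symm)).circles
        (Sum.elim σ₁ σ₂) = 1 ↔
      ∀ f₁ f₂, T₁.IsLocallyConstant σ₁ α₁ f₁ → T₂.IsLocallyConstant σ₂ α₂ f₂ →
        AgreeOnGlue g (T₁.outer f₁) (T₂.outer f₂) →
        (∀ j, Sum.elim (T₁.outer f₁) (T₂.outer f₂) (g (.inl (mate i.rev j))) =
          Sum.elim (T₁.outer f₁) (T₂.outer f₂) (g (.inl j))) →
        ∀ x y, Sum.elim f₁ f₂ x = Sum.elim f₁ f₂ y := by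
  refine (circles_closure_eq_one_iff (T := TangleDiagram.glue g T₁ T₂) (Sum.elim σ₁ σ₂) i _).trans
    ?_
  let T := TangleDiagram.glue g T₁ T₂
  let α : Fin (k₁ + k₂) → Fin 2 := Sum.elim α₁ α₂ ∘ finSumFinEquiv.symm
  let φ : T.Ends ≃ T₁.Ends ⊕ T₂.Ends := sumEnds g T₁.Crossing T₁.Point T₂.Crossing T₂.Point k₁ k₂
  have harc (x) : φ (T.arc x) = Sum.map T₁.arc T₂.arc (φ x) := φ.apply_symm_apply _
  have hmap (f₁ : T₁.Ends → Bool) (f₂ : T₂.Ends → Bool) (z : Fin 4 ⊕ Fin 4) :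
      Sum.elim f₁ f₂ (z.map (.boundary none) (.boundary none)) =
        Sum.elim (T₁.outer f₁) (T₂.outer f₂) z := by
    cases z <;> rfl
  have houter (f₁ : T₁.Ends → Bool) (f₂ : T₂.Ends → Bool) (j : Fin 4) :
      T.outer (fun x => Sum.elim f₁ f₂ (φ x)) j =
        Sum.elim (T₁.outer f₁) (T₂.outer f₂) (g (.inl j)) := hmap _ _ _
  have hloc (f₁ : T₁.Ends → Bool) (f₂ : T₂.Ends → Bool) :
      T.IsLocallyConstant (Sum.elim σ₁ σ₂) α (fun x => Sum.elim f₁ f₂ (φ x)) ↔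
        T₁.IsLocallyConstant σ₁ α₁ f₁ ∧ T₂.IsLocallyConstant σ₂ α₂ f₂ ∧
          AgreeOnGlue g (T₁.outer f₁) (T₂.outer f₂) := by
    have hhole (k : Fin k₁ ⊕ Fin k₂) (j : Fin 4) :
        φ (.boundary (some (finSumFinEquiv k)) j) =
          k.map (fun l => .boundary (some l) j) (fun l => .boundary (some l) j) := by
      show ((finSumFinEquiv.symm (finSumFinEquiv k)).map _ _) = _
      rw [Equiv.symm_apply_apply]
    have hholeJoin (k : Fin k₁ ⊕ Fin k₂) (j : Fin 4) :
        φ (T.partialJoin (Sum.elim σ₁ σ₂) α (.boundary (some (finSumFinEquiv k)) j)) =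
          k.map (fun l => .boundary (some l) (mate (α₁ l) j))
            (fun l => .boundary (some l) (mate (α₂ l) j)) := by
      refine (hhole k _).trans ?_
      cases k <;> simp [α]
    constructor
    · rintro ⟨ha, hj⟩
      have ha' (x) := ha (φ.symm x)
      simp only [harc, φ.apply_symm_apply] at ha'
      refine ⟨⟨fun x => ha' (.inl x), ?_⟩, ⟨fun x => ha' (.inr x), ?_⟩, fun s e => ?_⟩
      · rintro (⟨c, j⟩ | ⟨p, j⟩ | ⟨_ | k, j⟩)
        · exact hj (.crossing (.inl c) j)
        · exact hj (.point (.inl (.inl p)) j)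
        · rfl
        · have := hj (.boundary (some (finSumFinEquiv (.inl k))) j)
          simp only [hholeJoin, hhole] at this
          exact this
      · rintro (⟨c, j⟩ | ⟨p, j⟩ | ⟨_ | k, j⟩)
        · exact hj (.crossing (.inr c) j)
        · exact hj (.point (.inl (.inr p)) j)
        · rfl
        · have := hj (.boundary (some (finSumFinEquiv (.inr k))) j)
          simp only [hholeJoin, hhole] at this
          exact this
      · have := hj (.point (.inr s) e)
        exact (hmap f₁ f₂ _).symm.trans (this.trans (hmap f₁ f₂ _))
    · rintro ⟨⟨ha₁, hj₁⟩, ⟨ha₂, hj₂⟩, hg⟩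
      refine ⟨fun x => ?_, ?_⟩
      · simp only [harc]
        rcases φ x with y | y
        · exact ha₁ y
        · exact ha₂ y
      · rintro (⟨c | c, j⟩ | ⟨(p | p) | s, j⟩ | ⟨_ | k, j⟩)
        · exact hj₁ (.crossing c j)
        · exact hj₂ (.crossing c j)
        · exact hj₁ (.point p j)
        · exact hj₂ (.point p j)
        · exact (hmap f₁ f₂ _).trans ((hg s j).trans (hmap f₁ f₂ _).symm)
        · rfl
        · obtain ⟨k, rfl⟩ := finSumFinEquiv.surjective k
          simp only [hholeJoin, hhole]
          rcases k with k | k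
          · exact hj₁ (.boundary (some k) j)
          · exact hj₂ (.boundary (some k) j)
  constructor
  · intro h f₁ f₂ h₁ h₂ hg ho x y
    have := h _ ((hloc f₁ f₂).2 ⟨h₁, h₂, hg⟩) (fun j => by
      rw [houter, houter]
      exact ho j) (φ.symm x) (φ.symm y)
    simpa only [φ.apply_symm_apply] using this
  · intro h f hf ho x y
    obtain ⟨f₁, f₂, rfl⟩ : ∃ f₁ f₂, f = fun x => Sum.elim f₁ f₂ (φ x) :=
      ⟨fun x => f (φ.symm (.inl x)), fun x => f (φ.symm (.inr x)), funext fun x => by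
        obtain ⟨y | y, rfl⟩ := φ.symm.surjective x <;> simp⟩
    obtain ⟨h₁, h₂, hg⟩ := (hloc f₁ f₂).1 hf
    refine h f₁ f₂ h₁ h₂ hg (fun j => ?_) (φ x) (φ y)
    rw [← houter, ← houter]
    exact ho j

/-- Two pairs of disjoint arcs, glued and closed up, form a single circle. -/
def IsCircle (g : Fin 4 ⊕ Fin 2 × Fin 2 ≃ Fin 4 ⊕ Fin 4) (i m₁ m₂ : Fin 2) : Prop :=
  ∀ u₁ : Fin 4 → Bool, (∀ j, u₁ (mate m₁ j) = u₁ j) →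
    ∀ u₂ : Fin 4 → Bool, (∀ j, u₂ (mate m₂ j) = u₂ j) → AgreeOnGlue g u₁ u₂ →
      (∀ j, Sum.elim u₁ u₂ (g (.inl (mate i.rev j))) = Sum.elim u₁ u₂ (g (.inl j))) →
      ∀ x, Sum.elim u₁ u₂ x = u₁ 0

instance (g : Fin 4 ⊕ Fin 2 × Fin 2 ≃ Fin 4 ⊕ Fin 4) (i m₁ m₂ : Fin 2) :
    Decidable (IsCircle g i m₁ m₂) :=
  inferInstanceAs (Decidable (∀ u₁ : Fin 4 → Bool, (∀ j, u₁ (mate m₁ j) = u₁ j) →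
    ∀ u₂ : Fin 4 → Bool, (∀ j, u₂ (mate m₂ j) = u₂ j) → AgreeOnGlue g u₁ u₂ →
      (∀ j, Sum.elim u₁ u₂ (g (.inl (mate i.rev j))) = Sum.elim u₁ u₂ (g (.inl j))) →
      ∀ x, Sum.elim u₁ u₂ x = u₁ 0))

/-- A closed component of a summand survives gluing, as its indicator extends by zero. Without any,
everything is decided by the values on the outer circles, on which the matchings are the only
constraint from within the summands. -/
theorem circles_closure_glue_eq_one_iff_of_mate {g : Fin 4 ⊕ Fin 2 × Fin 2 ≃ Fin 4 ⊕ Fin 4}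
    {σ₁ : T₁.Crossing → Bool} {σ₂ : T₂.Crossing → Bool} {α₁ : Fin k₁ → Fin 2}
    {α₂ : Fin k₂ → Fin 2} {m₁ m₂ : Fin 2}
    (hm₁ : ∀ g : Fin 4 → Bool,
      (∃ f, T₁.IsLocallyConstant σ₁ α₁ f ∧ T₁.outer f = g) ↔ ∀ i, g (mate m₁ i) = g i)
    (hm₂ : ∀ g : Fin 4 → Bool,
      (∃ f, T₂.IsLocallyConstant σ₂ α₂ f ∧ T₂.outer f = g) ↔ ∀ i, g (mate m₂ i) = g i)
    (i : Fin 2) :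
    ((TangleDiagram.glue g T₁ T₂).closure i (Sum.elim α₁ α₂ ∘ finSumFinEquiv.symm)).circles
        (Sum.elim σ₁ σ₂) = 1 ↔
      T₁.NoClosedComponent σ₁ α₁ ∧ T₂.NoClosedComponent σ₂ α₂ ∧ IsCircle g i m₁ m₂ := by
  refine (circles_closure_glue_eq_one_iff g σ₁ σ₂ α₁ α₂ i).trans ?_
  have hzero {u₁ u₂ : Fin 4 → Bool} (h₁ : ∀ j, u₁ j = false) (h₂ : ∀ j, u₂ j = false) (z) :
      Sum.elim u₁ u₂ z = false := by
    cases z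
    · exact h₁ _
    · exact h₂ _
  constructor
  · refine fun h => ⟨fun f hf hf0 x => ?_, fun f hf hf0 x => ?_, fun u₁ hu₁ u₂ hu₂ hg ho x => ?_⟩
    · have hz := hzero hf0 (fun _ => rfl : ∀ j, T₂.outer (fun _ => false) j = false)
      exact (h f (fun _ => false) hf (isLocallyConstant_const _) (fun s e => by rw [hz, hz])
        (fun j => by rw [hz, hz]) (.inl x) (.inl (.boundary none 0))).trans (hf0 0)
    · have hz := hzero (fun _ => rfl : ∀ j, T₁.outer (fun _ => false) j = false) hf0
      exact (h (fun _ => false) f (isLocallyConstant_const _) hf (fun s e => by rw [hz, hz])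
        (fun j => by rw [hz, hz]) (.inr x) (.inr (.boundary none 0))).trans (hf0 0)
    · obtain ⟨f₁, hf₁, rfl⟩ := (hm₁ u₁).2 hu₁
      obtain ⟨f₂, hf₂, rfl⟩ := (hm₂ u₂).2 hu₂
      have := h f₁ f₂ hf₁ hf₂ hg ho (x.map (.boundary none) (.boundary none))
        (.inl (.boundary none 0))
      rcases x with x | x <;> exact this
  · rintro ⟨h₁, h₂, h⟩ f₁ f₂ hf₁ hf₂ hg ho
    have := h _ ((hm₁ _).1 ⟨f₁, hf₁, rfl⟩) _ ((hm₂ _).1 ⟨f₂, hf₂, rfl⟩) hg ho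
    have hc (x) : Sum.elim f₁ f₂ x = T₁.outer f₁ 0 := by
      rcases x with x | x
      · exact h₁.eq_const hf₁ (fun i => this (.inl i)) x
      · exact h₂.eq_const hf₂ (fun i => this (.inr i)) x
    intro x y
    rw [hc, hc]

theorem isCircle_hGlue : ∀ m₁ m₂ : Fin 2,
    (IsCircle hGlue 0 m₁ m₂ ↔ m₁ ≠ m₂) ∧ (IsCircle hGlue 1 m₁ m₂ ↔ m₁ = 1 ∧ m₂ = 1) := by
  decide

theorem isCircle_vGlue : ∀ m₁ m₂ : Fin 2,
    (IsCircle vGlue 0 m₁ m₂ ↔ m₁ = 0 ∧ m₂ = 0) ∧ (IsCircle vGlue 1 m₁ m₂ ↔ m₁ ≠ m₂) := by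
  decide

end TangleDiagram

/-! ### State sums -/

theorem exp_I_mul_pi_div_four_sq :
    Complex.exp (Complex.I * Real.pi / 4) ^ 2 = Complex.I := by
  rw [← Complex.exp_nat_mul]
  refine (congrArg Complex.exp ?_).trans Complex.exp_pi_div_two_mul_I
  push_cast
  ring

/-- The weight of a state at `A = e^{iπ/4}`. -/
noncomputable def stateWeight {C : Type} [Fintype C] (σ : C → Bool) : ℂ :=
  ∏ c, if σ c = true then Complex.exp (Complex.I * Real.pi / 4)
    else (Complex.exp (Complex.I * Real.pi / 4))⁻¹

open scoped Classical in
/-- At `A = e^{iπ/4}`, only the states whose resolution is a single circle contribute. -/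
theorem LinkDiagram.kauffman_eq_sum (L : LinkDiagram) [Nonempty L.Ends] :
    L.kauffman = ∑ σ : L.State, stateWeight σ * if L.circles σ = 1 then 1 else 0 := by
  rw [LinkDiagram.kauffman, LinkDiagram.bracket]
  refine Finset.sum_congr (by congr!) fun σ _ => ?_
  have h0 (A : ℂ) (hA : A ^ 2 = Complex.I) : -A ^ 2 - A⁻¹ ^ 2 = 0 := by
    rw [inv_pow, hA, Complex.inv_I, sub_neg_eq_add, neg_add_cancel]
  rw [h0 _ exp_I_mul_pi_div_four_sq,
    L.zero_pow_circles, stateWeight, Finset.prod_ite, Finset.prod_const, Finset.prod_const]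
  simp only [Bool.not_eq_true]

namespace TangleDiagram

variable {k₁ k₂ : ℕ} {T₁ : TangleDiagram k₁} {T₂ : TangleDiagram k₂}

open scoped Classical in
theorem kauffman_closure_eq_sum {n : ℕ} (T : TangleDiagram n) (i : Fin 2) (α : Fin n → Fin 2) :
    (T.closure i α).kauffman = ∑ σ : T.Crossing → Bool,
      stateWeight σ * if (T.closure i α).circles σ = 1 then 1 else 0 :=
  (T.closure i α).kauffman_eq_sum

open scoped Classical in
theorem kauffman_closure_glue_eq_sum (g : Fin 4 ⊕ Fin 2 × Fin 2 ≃ Fin 4 ⊕ Fin 4) (i : Fin 2)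
    (α : Fin (k₁ + k₂) → Fin 2) :
    ((TangleDiagram.glue g T₁ T₂).closure i α).kauffman =
      ∑ σ₁ : T₁.Crossing → Bool, ∑ σ₂ : T₂.Crossing → Bool, stateWeight σ₁ * stateWeight σ₂ *
        if ((TangleDiagram.glue g T₁ T₂).closure i α).circles (Sum.elim σ₁ σ₂) = 1 then 1
        else 0 := by
  rw [kauffman_closure_eq_sum, ← Fintype.sum_prod_type']
  refine (Fintype.sum_equiv (Equiv.sumArrowEquivProdArrow T₁.Crossing T₂.Crossing Bool).symm _ _
    fun σ => ?_).symm
  refine congrArg₂ (· * ·) ?_ rfl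
  exact (Fintype.prod_sum_type fun c => if Sum.elim σ.1 σ.2 c = true then
    Complex.exp (Complex.I * Real.pi / 4) else (Complex.exp (Complex.I * Real.pi / 4))⁻¹).symm

open scoped Classical in
theorem kauffman_mul_kauffman (i j : Fin 2) (α₁ : Fin k₁ → Fin 2) (α₂ : Fin k₂ → Fin 2) :
    (T₁.closure i α₁).kauffman * (T₂.closure j α₂).kauffman =
      ∑ σ₁ : T₁.Crossing → Bool, ∑ σ₂ : T₂.Crossing → Bool, stateWeight σ₁ * stateWeight σ₂ *
        ((if (T₁.closure i α₁).circles σ₁ = 1 then 1 else 0) *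
          if (T₂.closure j α₂).circles σ₂ = 1 then 1 else 0) := by
  rw [kauffman_closure_eq_sum, kauffman_closure_eq_sum, Finset.sum_mul_sum]
  exact Finset.sum_congr rfl fun _ _ => Finset.sum_congr rfl fun _ _ => mul_mul_mul_comm _ _ _ _

/-- If the only way to a single circle is that the arcs are `m₁` and `m₂`. -/
theorem kauffman_closure_glue_of_isCircle_iff_eq (hT₁ : T₁.IsPlanar) (hT₂ : T₂.IsPlanar)
    {g : Fin 4 ⊕ Fin 2 × Fin 2 ≃ Fin 4 ⊕ Fin 4} {i n₁ n₂ : Fin 2}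
    (h : ∀ m₁ m₂, IsCircle g i m₁ m₂ ↔ m₁ = n₁ ∧ m₂ = n₂)
    (α₁ : Fin k₁ → Fin 2) (α₂ : Fin k₂ → Fin 2) :
    ((TangleDiagram.glue g T₁ T₂).closure i (Sum.elim α₁ α₂ ∘ finSumFinEquiv.symm)).kauffman =
      (T₁.closure n₁ α₁).kauffman * (T₂.closure n₂ α₂).kauffman := by
  classical
  rw [kauffman_closure_glue_eq_sum, kauffman_mul_kauffman]
  refine Finset.sum_congr rfl fun σ₁ _ => Finset.sum_congr rfl fun σ₂ _ => congrArg _ ?_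
  obtain ⟨m₁, hm₁⟩ := hT₁.exists_mate σ₁ α₁
  obtain ⟨m₂, hm₂⟩ := hT₂.exists_mate σ₂ α₂
  rw [ite_zero_mul_ite_zero, one_mul]
  refine if_congr ?_ rfl rfl
  refine (circles_closure_glue_eq_one_iff_of_mate hm₁ hm₂ i).trans ?_
  rw [circles_closure_eq_one_iff_of_mate hm₁, circles_closure_eq_one_iff_of_mate hm₂, h]
  tauto

/-- If a single circle arises from arcs that are different. -/
theorem kauffman_closure_glue_of_isCircle_iff_ne (hT₁ : T₁.IsPlanar) (hT₂ : T₂.IsPlanar)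
    {g : Fin 4 ⊕ Fin 2 × Fin 2 ≃ Fin 4 ⊕ Fin 4} {i : Fin 2}
    (h : ∀ m₁ m₂, IsCircle g i m₁ m₂ ↔ m₁ ≠ m₂)
    (α₁ : Fin k₁ → Fin 2) (α₂ : Fin k₂ → Fin 2) :
    ((TangleDiagram.glue g T₁ T₂).closure i (Sum.elim α₁ α₂ ∘ finSumFinEquiv.symm)).kauffman =
      (T₁.closure 0 α₁).kauffman * (T₂.closure 1 α₂).kauffman +
        (T₁.closure 1 α₁).kauffman * (T₂.closure 0 α₂).kauffman := by
  classical
  rw [kauffman_closure_glue_eq_sum, kauffman_mul_kauffman, kauffman_mul_kauffman,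
    ← Finset.sum_add_distrib]
  refine Finset.sum_congr rfl fun σ₁ _ => ?_
  rw [← Finset.sum_add_distrib]
  refine Finset.sum_congr rfl fun σ₂ _ => ?_
  rw [← mul_add]
  refine congrArg _ ?_
  obtain ⟨m₁, hm₁⟩ := hT₁.exists_mate σ₁ α₁
  obtain ⟨m₂, hm₂⟩ := hT₂.exists_mate σ₂ α₂
  have hg := (circles_closure_glue_eq_one_iff_of_mate (g := g) hm₁ hm₂ i)
  rw [h] at hg
  -- In `Fin 2`, `m₁ ≠ m₂` means `(0, 1)` or `(1, 0)`; these exclude each other, so the indicators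
  -- add.
  refine (if_congr hg rfl rfl).trans ?_
  simp only [circles_closure_eq_one_iff_of_mate hm₁, circles_closure_eq_one_iff_of_mate hm₂]
  by_cases h₁ : T₁.NoClosedComponent σ₁ α₁ <;> by_cases h₂ : T₂.NoClosedComponent σ₂ α₂ <;>
    fin_cases m₁ <;> fin_cases m₂ <;> simp [h₁, h₂]

end TangleDiagram

/-! ### Numbering of the columns -/

theorem pairIndex_val (k₁ k₂ : ℕ) (x : Fin (2 ^ k₁) × Fin (2 ^ k₂)) :
    (pairIndex k₁ k₂ x : ℕ) = x.2 + 2 ^ k₂ * x.1 := rfl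

/-- The binary expansion of `2 ^ k₂ * i + j` is that of `i` followed by the `k₂` digits of `j`. -/
theorem dictIndex_pairIndex (k₁ k₂ : ℕ) (x : Fin (2 ^ k₁) × Fin (2 ^ k₂)) :
    dictIndex (k₁ + k₂) (pairIndex k₁ k₂ x) =
      Sum.elim (dictIndex k₁ x.1) (dictIndex k₂ x.2) ∘ finSumFinEquiv.symm := by
  funext l
  obtain ⟨l, rfl⟩ := finSumFinEquiv.surjective l
  rw [Function.comp_apply, Equiv.symm_apply_apply]
  have hx := x.2.isLt
  rcases l with l | l <;> have hl := l.isLt <;> refine Fin.ext ?_ <;>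
    simp only [dictIndex, pairIndex_val, finSumFinEquiv_apply_left, finSumFinEquiv_apply_right,
      Sum.elim_inl, Sum.elim_inr, Fin.val_castAdd, Fin.val_natAdd]
  · rw [show k₁ + k₂ - 1 - (l : ℕ) = k₂ + (k₁ - 1 - l) by omega, pow_add, ← Nat.div_div_eq_div_mul,
      Nat.add_mul_div_left _ _ (by positivity), Nat.div_eq_of_lt hx, zero_add]
  · rw [show k₁ + k₂ - 1 - (k₁ + (l : ℕ)) = k₂ - 1 - l by omega]
    have (y : ℕ) : 2 ^ k₂ * y = 2 ^ (k₂ - 1 - (l : ℕ)) * (2 * (2 ^ (l : ℕ) * y)) := by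
      rw [show 2 ^ k₂ = 2 ^ ((k₂ - 1 - (l : ℕ)) + 1 + l) by congr 1; omega, pow_add, pow_add]
      ring
    rw [this, Nat.add_mul_div_left _ _ (by positivity), Nat.add_mul_mod_self_left]

/-- For `k < 2 ^ n`, `expo n k` counts the binary digits `1` of `k`, which is additive under
concatenation. -/
theorem expo_add (k₁ k₂ i j : ℕ) (hj : j < 2 ^ k₂) (hi : i < 2 ^ k₁) :
    expo (k₁ + k₂) (j + 2 ^ k₂ * i) = expo k₁ i + expo k₂ j := by
  induction k₁ generalizing i with
  | zero =>
    obtain rfl : i = 0 := by simpa using hi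
    simp [expo]
  | succ k ih =>
    rw [show k + 1 + k₂ = k + k₂ + 1 by ring, expo, expo, pow_add 2 k k₂]
    rcases lt_or_ge i (2 ^ k) with h | h
    · have : j + 2 ^ k₂ * i < 2 ^ k * 2 ^ k₂ := by nlinarith
      rw [if_pos this, if_pos h, ih i h]
    · obtain ⟨i, rfl⟩ := Nat.exists_eq_add_of_le h
      have h' : 2 ^ k * 2 ^ k₂ ≤ j + 2 ^ k₂ * (2 ^ k + i) := by
        rw [mul_add, mul_comm (2 ^ k)]; omega
      rw [if_neg (not_lt.2 h'), if_neg (not_lt.2 h), Nat.add_sub_cancel_left,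
        show j + 2 ^ k₂ * (2 ^ k + i) - 2 ^ k * 2 ^ k₂ = j + 2 ^ k₂ * i by
          rw [mul_add, mul_comm (2 ^ k)]; omega,
        ih i (by rw [pow_succ] at hi; omega)]
      ring

theorem expo_pairIndex (k₁ k₂ : ℕ) (x : Fin (2 ^ k₁) × Fin (2 ^ k₂)) :
    expo (k₁ + k₂) (pairIndex k₁ k₂ x) = expo k₁ x.1 + expo k₂ x.2 :=
  expo_add _ _ _ _ x.2.isLt x.1.isLt

/-! ### The bracket matrices of connect sums -/

namespace TangleDiagram

variable {k₁ k₂ : ℕ} {T₁ : TangleDiagram k₁} {T₂ : TangleDiagram k₂}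

/-- Second rows carry a factor `i`. Each product on the right has one such factor more than the
corresponding row of the sum, whence the extra `Complex.I`; in the vertical case the factors
balance. -/
theorem bracketMatrix_hsum (hT₁ : T₁.IsPlanar) (hT₂ : T₂.IsPlanar)
    (x : Fin (2 ^ k₁) × Fin (2 ^ k₂)) :
    Complex.I * (T₁.hsum T₂).bracketMatrix 0 (pairIndex k₁ k₂ x) =
        T₁.bracketMatrix 0 x.1 * T₂.bracketMatrix 1 x.2 +
          T₁.bracketMatrix 1 x.1 * T₂.bracketMatrix 0 x.2 ∧
      Complex.I * (T₁.hsum T₂).bracketMatrix 1 (pairIndex k₁ k₂ x) =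
        T₁.bracketMatrix 1 x.1 * T₂.bracketMatrix 1 x.2 := by
  simp only [bracketMatrix, Matrix.of_apply, expo_pairIndex, dictIndex_pairIndex, hsum,
    kauffman_closure_glue_of_isCircle_iff_ne hT₁ hT₂ fun m₁ m₂ => (isCircle_hGlue m₁ m₂).1,
    kauffman_closure_glue_of_isCircle_iff_eq hT₁ hT₂ fun m₁ m₂ => (isCircle_hGlue m₁ m₂).2,
    Fin.val_zero, Fin.val_one, pow_zero, pow_one, pow_add]
  constructor <;> ring

theorem bracketMatrix_vsum (hT₁ : T₁.IsPlanar) (hT₂ : T₂.IsPlanar)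
    (x : Fin (2 ^ k₁) × Fin (2 ^ k₂)) :
    (T₁.vsum T₂).bracketMatrix 0 (pairIndex k₁ k₂ x) =
        T₁.bracketMatrix 0 x.1 * T₂.bracketMatrix 0 x.2 ∧
      (T₁.vsum T₂).bracketMatrix 1 (pairIndex k₁ k₂ x) =
        T₁.bracketMatrix 1 x.1 * T₂.bracketMatrix 0 x.2 +
          T₁.bracketMatrix 0 x.1 * T₂.bracketMatrix 1 x.2 := by
  simp only [bracketMatrix, Matrix.of_apply, expo_pairIndex, dictIndex_pairIndex, vsum,
    kauffman_closure_glue_of_isCircle_iff_eq hT₁ hT₂ fun m₁ m₂ => (isCircle_vGlue m₁ m₂).1,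
    kauffman_closure_glue_of_isCircle_iff_ne hT₁ hT₂ fun m₁ m₂ => (isCircle_vGlue m₁ m₂).2,
    Fin.val_zero, Fin.val_one, pow_zero, pow_one, pow_add]
  constructor <;> ring

/-- The integer matrices among the multiples of the bracket matrix by eighth roots of unity are
determined up to sign. -/
theorem invariant_eq_projClass {n : ℕ} {T : TangleDiagram n} {M : Matrix (Fin 2) (Fin (2 ^ n)) ℤ}
    (hM : M ∈ T.invariant) : T.invariant = projClass M := by
  obtain ⟨u, hu, hM⟩ := hM
  have hu0 : u ≠ 0 := by
    rintro rfl
    norm_num at hu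
  refine Set.ext fun M' => ⟨?_, ?_⟩
  · rintro ⟨v, hv, hM'⟩
    have hentry (r c) : (M' r c : ℂ) = v / u * M r c := by
      have h1 := congrFun (congrFun hM r) c
      have h2 := congrFun (congrFun hM' r) c
      simp only [Matrix.map_apply, Matrix.smul_apply, smul_eq_mul] at h1 h2
      rw [h1, h2]
      field_simp
    have hq : v / u = 1 ∨ v / u = -1 ∨ M = 0 := by
      by_cases h : M = 0
      · exact Or.inr (Or.inr h)
      obtain ⟨r, c, hrc⟩ : ∃ r c, M r c ≠ 0 := by
        by_contra! h'
        exact h (Matrix.ext h')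
      have hrc' : (M r c : ℂ) ≠ 0 := Int.cast_ne_zero.2 hrc
      -- The ratio of two multipliers is an eighth root of unity, and integers with equal eighth
      -- powers agree up to sign.
      have h8 : (M' r c) ^ 8 = (M r c) ^ 8 := by
        have : ((M' r c : ℂ)) ^ 8 = (M r c) ^ 8 := by
          rw [hentry, mul_pow, div_pow, hv, hu, div_one, one_mul]
        exact_mod_cast this
      have hq := hentry r c
      rcases (pow_eq_pow_iff_of_ne_zero (by norm_num)).1 h8 with h | ⟨h, _⟩
      · exact Or.inl (mul_right_cancel₀ hrc' (by rw [← hq, h, one_mul]))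
      · exact Or.inr (Or.inl (mul_right_cancel₀ hrc' (by rw [← hq, h, Int.cast_neg, neg_one_mul])))
    rcases hq with h | h | rfl
    · exact Or.inl (Matrix.ext fun r c => by exact_mod_cast 
        (show (M' r c : ℂ) = M r c by rw [hentry, h, one_mul]))
    · refine Or.inr (Matrix.ext fun r c => ?_)
      have : (M' r c : ℂ) = -M r c := by rw [hentry, h, neg_one_mul]
      exact_mod_cast this
    · exact Or.inl (Matrix.ext fun r c => by simpa using hentry r c)
  · rintro (rfl | rfl)
    · exact ⟨u, hu, hM⟩
    · refine ⟨-u, by rw [Even.neg_pow (by decide), hu], ?_⟩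
      rw [neg_smul, ← hM]
      ext r c
      simp

end TangleDiagram

end PBT

theorem theorem3p3 (k₁ k₂ : ℕ) (T₁ : PBT.TangleDiagram k₁) (T₂ : PBT.TangleDiagram k₂)
    (hT₁ : T₁.IsPlanar) (hT₂ : T₂.IsPlanar)
    (a : Matrix (Fin 2) (Fin (2 ^ k₁)) ℤ) (b : Matrix (Fin 2) (Fin (2 ^ k₂)) ℤ)
    (ha : T₁.invariant = PBT.projClass a) (hb : T₂.invariant = PBT.projClass b) :
    (T₁.hsum T₂).invariant = PBT.projClass (PBT.hMatrix a b) ∧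
      (T₁.vsum T₂).invariant = PBT.projClass (PBT.vMatrix a b) := by
  obtain ⟨z, hz, ha⟩ : a ∈ T₁.invariant := ha ▸ Or.inl rfl
  obtain ⟨w, hw, hb⟩ : b ∈ T₂.invariant := hb ▸ Or.inl rfl
  have ha (r i) : (a r i : ℂ) = z * T₁.bracketMatrix r i := congrFun (congrFun ha r) i
  have hb (r j) : (b r j : ℂ) = w * T₂.bracketMatrix r j := congrFun (congrFun hb r) j
  constructor
  -- The multiplier absorbs the extra `Complex.I` of `bracketMatrix_hsum`; it is still an eighth
  -- root of unity.
  · refine PBT.TangleDiagram.invariant_eq_projClass ⟨z * w * Complex.I, ?_, ?_⟩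
    · rw [mul_pow, mul_pow, hz, hw, show (8 : ℕ) = 4 * 2 by rfl, pow_mul, Complex.I_pow_four]
      norm_num
    · ext r c
      obtain ⟨x, rfl⟩ := (PBT.pairIndex k₁ k₂).surjective c
      obtain ⟨h0, h1⟩ := PBT.TangleDiagram.bracketMatrix_hsum hT₁ hT₂ x
      rw [Matrix.smul_apply, smul_eq_mul, Matrix.map_apply, mul_assoc (z * w)]
      fin_cases r
      · simp only [PBT.hMatrix, Matrix.of_apply, Equiv.symm_apply_apply, Fin.zero_eta,
          Matrix.cons_val_zero, h0]
        push_cast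
        rw [ha, ha, hb, hb]
        ring
      · simp only [PBT.hMatrix, Matrix.of_apply, Equiv.symm_apply_apply, Fin.mk_one,
          Matrix.cons_val_one, Matrix.cons_val_zero, h1]
        push_cast
        rw [ha, hb]
        ring
  · refine PBT.TangleDiagram.invariant_eq_projClass ⟨z * w, ?_, ?_⟩
    · rw [mul_pow, hz, hw, one_mul]
    · ext r c
      obtain ⟨x, rfl⟩ := (PBT.pairIndex k₁ k₂).surjective c
      obtain ⟨h0, h1⟩ := PBT.TangleDiagram.bracketMatrix_vsum hT₁ hT₂ x
      rw [Matrix.smul_apply, smul_eq_mul, Matrix.map_apply]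
      fin_cases r
      · simp only [PBT.vMatrix, Matrix.of_apply, Equiv.symm_apply_apply, Fin.zero_eta,
          Matrix.cons_val_zero, h0]
        push_cast
        rw [ha, hb]
        ring
      · simp only [PBT.vMatrix, Matrix.of_apply, Equiv.symm_apply_apply, Fin.mk_one,
          Matrix.cons_val_one, Matrix.cons_val_zero, h1]
        push_cast
        rw [ha, ha, hb, hb]
        ring
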